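/- **Theorem 1 (Tiling).** Let $V$ be a Euclidean space of finite dimension and $\Lambda\subset V$ a lattice of full rank. A *tiling* of a set $A$ is a family of pairwise disjoint subsets of $A$ that cover $A$. A *fundamental domain* of a sublattice $L\subseteq\Lambda$ is a connected, bounded set $D\subseteq\operatorname{lin}(L)$, with measurable intersection with every affine subspace, such that the translates $x+D$ ($x\in L$) tile $\operatorname{lin}(L)$. A *pointed rational cone* is a cone $C\subseteq V$ defined by finitely many inequalities $\langle w,x\rangle\le 0$ with $w\in\Lambda$ and containing no nontrivial linear subspace. Write $C^\vee=\{x:\langle x,y\rangle\le 0\ \forall y\in C\}$, $C^\perp=\{x:\langle x,y\rangle=0\ \forall y\in C\}$ and $L(C)=\Lambda\cap C^\perp$. Faces are understood to be nonempty. For every pointed rational cone $C$ fix a fundamental domain $T(C)$ of $L(C)$ and put $T=T(\{0\})$. The *covering domain complex* of a set $Q\subseteq V$ is $$\overline{\mathrm{DC}}(Q)=\bigcup_{x\in\Lambda,\ (x+T)\cap Q\neq\varnothing}(x+T).$$ The regions are defined recursively by $R(\{0\})=T$ and, for a pointed rational cone $C\ne\{0\}$, $$R(C)=\Big(V\setminus\bigcup_{K<C}\big(X_K^C+R(K)\big)\Big)\cap\big(T(C)+\operatorname{lin}(C)\big)\cap\overline{\mathrm{DC}}(C^\vee),$$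 where $K$ ranges over the proper faces of $C$ and $X_K^C$ is the set of all $x\in L(K)$ such that 1. $x+R(K)\subseteq\operatorname{int}(M^\vee)$ for all rays (one-dimensional faces) $M\le C$ with $M\not\le K$, and 2. $(x+R(K))\cap(x'+R(K'))=\varnothing$ for all faces $K'<C$ incomparable to $K$ and all $x'\in L(K')$. Moreover put $X_C^C=\{0\}$. Let $P\subseteq V$ be a full-dimensional lattice polytope, that is, the convex hull of finitely many points of $\Lambda$ with $\operatorname{aff}(P)=V$. For a face $f\le P$ let $N_f=\{x\in V:\langle x,y-s\rangle\le 0\ \ \forall y\in P,\ s\in f\}$ be its outer normal cone and, for an integer $t>0$, let $$\mathcal X(tf)=\bigcap_{v\text{ vertex of }f}\big(tv+X^{N_v}_{N_f}\big)$$ be the set of feasible lattice points of $tf$. Then there exists $t_0\in\mathbb Z_{>0}$ such that for every integer $t\ge t_0$ the family $$\{\,x+R(N_f)\ :\ f\le P,\ x\in\mathcal X(tf)\,\}$$ is a tiling of $\overline{\mathrm{DC}}(tP)$. -/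

import Mathlib

open scoped Pointwise RealInnerProductSpace

namespace LatticeTiling

variable {V : Type*} [NormedAddCommGroup V] [InnerProductSpace ℝ V]

/-! ### Faces, polar cones, normal cones -/

/-- The (nonempty) faces of a polyhedron: the polyhedron itself and its nonempty intersections
with supporting hyperplanes.  The order on faces is inclusion. -/
def IsFace (P F : Set V) : Prop := IsExposed ℝ P F ∧ F.Nonempty

/-- `F < P` in the face order. -/
def IsProperFace (P F : Set V) : Prop := IsFace P F ∧ F ≠ P

/-- `M` is a ray of the cone `C`: a one-dimensional face of `C`. -/
def IsRay (C M : Set V) : Prop := IsFace C M ∧ Module.finrank ℝ (Submodule.span ℝ M) = 1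

/-- The polar cone `C^∨`. -/
def polar (C : Set V) : Set V := {x | ∀ y ∈ C, ⟪x, y⟫ ≤ 0}

/-- The orthogonal space `C^⊥`. -/
noncomputable def orth (C : Set V) : Submodule ℝ V := (Submodule.span ℝ C)ᗮ

/-- The outer normal cone of `P` at the face `f`: all `x` such that `⟪x, ·⟫` attains its maximum
over `P` at every point of `f` (equivalently, at one relative interior point of `f`). -/
def normalCone (P f : Set V) : Set V := {x | ∀ s ∈ f, ∀ y ∈ P, ⟪x, y - s⟫ ≤ 0}

/-! ### Lattices, tilings, fundamental domains -/

/-- `C` is a pointed rational cone: the solution set of finitely many homogeneous inequalities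
`⟪x, w⟫ ≤ 0` with `w` in the lattice, containing no nontrivial linear subspace. -/
def IsPointedRationalCone (Λ : Submodule ℤ V) (C : Set V) : Prop :=
  (∃ W : Finset V, (W : Set V) ⊆ Λ ∧ C = {x | ∀ w ∈ W, ⟪x, w⟫ ≤ 0}) ∧
    ∀ U : Submodule ℝ V, (U : Set V) ⊆ C → U = ⊥

/-- The induced lattice `L(C) = Λ ∩ C^⊥`. -/
noncomputable def inducedLattice (Λ : Submodule ℤ V) (C : Set V) : Submodule ℤ V :=
  Λ ⊓ (orth C).restrictScalars ℤ

/-- A (strict) tiling of `A`: a family of subsets of `A` that covers `A` and whose members are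
pairwise disjoint. -/
def IsTiling {ι : Type*} (A : Set V) (F : ι → Set V) : Prop :=
  (∀ i, F i ⊆ A) ∧ A ⊆ ⋃ i, F i ∧ ∀ i j, i ≠ j → Disjoint (F i) (F j)

/-- `D` is a fundamental domain of the lattice `L` in the linear hull of `L`. -/
structure IsFundamentalDomain [FiniteDimensional ℝ V] [MeasurableSpace V] [BorelSpace V]
    (L : Submodule ℤ V) (D : Set V) : Prop where
  subset_lin : D ⊆ Submodule.span ℝ (L : Set V)
  connected : IsConnected D
  bounded : Bornology.IsBounded D
  tiling : IsTiling (Submodule.span ℝ (L : Set V) : Set V) (fun x : L => (x : V) +ᵥ D)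
  /-- The intersection of `D` with every affine subspace `a + S` is Lebesgue measurable there. -/
  measurable : ∀ (S : Submodule ℝ V) (a : V),
    MeasureTheory.NullMeasurableSet {s : S | a + (s : V) ∈ D} MeasureTheory.volume

/-- The covering domain complex of `Q`: the union of all lattice translates of the fundamental
domain `D` of `Λ` that meet `Q`. -/
def coveringComplex (Λ : Submodule ℤ V) (D Q : Set V) : Set V :=
  ⋃ x ∈ {x : V | x ∈ Λ ∧ ((x +ᵥ D) ∩ Q).Nonempty}, x +ᵥ D

/-! ### Regions -/

open Classical in
/-- The set `X_K^C` of translation vectors for a face `K ≤ C`, with respect to regions `R`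
(only the values of `R` at proper faces of `C` are used); by convention `X_C^C = {0}`. -/
noncomputable def translationSet (Λ : Submodule ℤ V) (R : Set V → Set V) (K C : Set V) : Set V :=
  if K = C then {0} else
    {x | x ∈ inducedLattice Λ K ∧
      (∀ M, IsRay C M → ¬ M ⊆ K → x +ᵥ R K ⊆ interior (polar M)) ∧
      (∀ K', IsProperFace C K' → ¬ K ⊆ K' → ¬ K' ⊆ K →
        ∀ x' ∈ inducedLattice Λ K', Disjoint (x +ᵥ R K) (x' +ᵥ R K'))}

open Classical in
/-- One step of the construction of regions: the region of `C`, given the regions `R K` of all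
proper faces `K` of `C` and the choice `T` of fundamental domains. -/
noncomputable def regionStep (Λ : Submodule ℤ V) (T R : Set V → Set V) (C : Set V) : Set V :=
  if C = {0} then T {0} else
    (⋃ K ∈ {K | IsProperFace C K}, translationSet Λ R K C + R K)ᶜ ∩
      (T C + (Submodule.span ℝ C : Set V)) ∩ coveringComplex Λ (T {0}) (polar C)

/-- Proper faces have smaller dimension. -/
theorem IsProperFace.finrank_lt [FiniteDimensional ℝ V] {C K : Set V} (h : IsProperFace C K) :
    Module.finrank ℝ (vectorSpan ℝ K) < Module.finrank ℝ (vectorSpan ℝ C) := by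
  obtain ⟨⟨hexp, hne⟩, hKC⟩ := h
  obtain ⟨l, hl⟩ := hexp hne
  obtain ⟨k, hk⟩ := hne
  have hsub : K ⊆ C := by rw [hl]; exact fun x hx => hx.1
  have hker : vectorSpan ℝ K ≤ LinearMap.ker (l : V →ₗ[ℝ] ℝ) := by
    rw [vectorSpan, Submodule.span_le]
    rintro _ ⟨a, ha, b, hb, rfl⟩
    rw [hl] at ha hb
    have h1 := ha.2 b hb.1
    have h2 := hb.2 a ha.1
    simp only [vsub_eq_sub, SetLike.mem_coe, LinearMap.mem_ker, map_sub]
    exact sub_eq_zero.2 (le_antisymm h2 h1)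
  obtain ⟨c, hc, hcK⟩ : ∃ c ∈ C, c ∉ K := by
    by_contra hcon
    push Not at hcon
    exact hKC (Set.Subset.antisymm hsub hcon)
  refine Submodule.finrank_lt_finrank_of_lt (lt_of_le_of_ne (vectorSpan_mono ℝ hsub) ?_)
  intro heq
  have hmem : k - c ∈ vectorSpan ℝ K := by
    rw [heq]; exact vsub_mem_vectorSpan ℝ (hsub hk) hc
  have h0 : l (k - c) = 0 := hker hmem
  rw [map_sub, sub_eq_zero] at h0
  apply hcK
  rw [hl] at hk ⊢
  exact ⟨hc, fun y hy => h0 ▸ hk.2 y hy⟩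

open Classical in
/-- The region `R(C)` of a cone `C`, by recursion over the proper faces of `C`; see
`region_eq` for the recursive equation. -/
noncomputable def region [FiniteDimensional ℝ V] (Λ : Submodule ℤ V) (T : Set V → Set V)
    (C : Set V) : Set V :=
  regionStep Λ T (fun K => if _h : IsProperFace C K then region Λ T K else ∅) C
termination_by Module.finrank ℝ (vectorSpan ℝ C)
decreasing_by exact IsProperFace.finrank_lt _h

open Classical in
/-- The recursive equation of the regions. -/
theorem region_eq [FiniteDimensional ℝ V] (Λ : Submodule ℤ V) (T : Set V → Set V) (C : Set V) :
    region Λ T C = regionStep Λ T (region Λ T) C := by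
  rw [region]
  unfold regionStep
  split_ifs with h
  · rfl
  · congr 3
    refine Set.iUnion₂_congr fun K hK => ?_
    have hK' : IsProperFace C K := hK
    have hR : translationSet Λ
        (fun K => if _h : IsProperFace C K then region Λ T K else ∅) K C =
        translationSet Λ (region Λ T) K C := by
      unfold translationSet
      rw [if_neg hK'.2, if_neg hK'.2]
      ext x
      simp +contextual [hK']
    rw [hR]
    simp [hK']

/-! ### Lattice polytopes and feasible lattice points -/

/-- `P` is a lattice polytope: the convex hull of finitely many lattice points. -/
def IsLatticePolytope (Λ : Submodule ℤ V) (P : Set V) : Prop :=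
  ∃ S : Finset V, (S : Set V) ⊆ Λ ∧ P = convexHull ℝ (S : Set V)

/-- The set of feasible lattice points in `t f`, where `f` is a face of the polytope `P`: the
intersection of the sets `t v + X^{N_v}_{N_f}` over all vertices `v` of `f`. -/
noncomputable def feasiblePoints [FiniteDimensional ℝ V] (Λ : Submodule ℤ V) (T : Set V → Set V)
    (P : Set V) (t : ℕ) (f : Set V) : Set V :=
  ⋂ v ∈ f.extremePoints ℝ, ((t : ℝ) • v) +ᵥ
    translationSet Λ (region Λ T) (normalCone P f) (normalCone P {v})

end LatticeTiling

/-! The tiling is local: near a vertex `tv` the set `tP` looks like `tv + N_v^∨`, and the claim is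
first proved for polar cones, then glued.

For a pointed rational cone `C`, the translates `x + R(G)` with `G ≤ C` and `x ∈ X_G^C` behave like
a tiling of `DC(C^∨)`, once `X_C^C` is enlarged to `L(C)` for the covering. Covering and
disjointness are built into the recursion: modulo `L(C)` a point lies in `R(C)` or in one of the
translates removed from it (`exists_mem_region`); two translates are disjoint by this removal if
their faces are comparable, and by condition 2 if not (`cone_tiling_unique`). Containment in
`DC(C^∨)` needs the connectedness of `T`: a cell that meets `x + R(K)` cannot reach the wall of a
ray outside `K` (`cell_inner_neg`, `translate_region_subset`).

The sets `X_G^C` are compatible along faces. For `G ≤ K ≤ C` an element of `X_G^C` is one of `X_G^K`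
(again with `L(K)` for `X_K^K`), the latter is invariant under `L(K)`, and conversely an element of
`X_G^K` belongs to `X_G^C` if its translate is far inside the walls of the rays outside `K`
(`mem_translationSet_of_far`). By induction on the dimension this also bounds the regions
(`isBounded_region`): a point of `R(C)` far from those walls would already have been removed.

Since all regions are bounded, for large `t` only walls with a common vertex are simultaneously near
to a point of `DC(tP)` (`eventually_exists_common_vertex`). Covering and disjointness at a point
then follow from the cone statement at a suitable vertex, and compatibility along `N_u ∩ N_v`
transfers feasibility from one vertex of `f` to the others. For containment, a wall is controlled
from a vertex of `f` lying on it, or is far away (`eventually_inner_neg`). Vertex cones are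
full-dimensional, so there `L(N_v) = {0}` and the enlargement disappears. -/

open scoped Pointwise RealInnerProductSpace
open Filter Topology

namespace LatticeTiling

/-! ### Polyhedral cones and their faces -/

section Cones

variable {V : Type*} [NormedAddCommGroup V] [InnerProductSpace ℝ V]

/-- The polyhedral cone cut out by the inequalities `⟪x, w⟫ ≤ 0` for `w ∈ W`. -/
def halfspaceCone (W : Finset V) : Set V := {x | ∀ w ∈ W, ⟪x, w⟫ ≤ 0}

/-- `F` is an extreme subcone of the cone `C`. -/
structure IsExtremeCone (C F : Set V) : Prop where
  subset : F ⊆ C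
  zero_mem : (0 : V) ∈ F
  add_mem : ∀ x ∈ F, ∀ y ∈ F, x + y ∈ F
  smul_mem : ∀ x ∈ F, ∀ a : ℝ, 0 ≤ a → a • x ∈ F
  left_mem : ∀ x ∈ C, ∀ y ∈ C, x + y ∈ F → x ∈ F

theorem isExtremeCone_refl (W : Finset V) :
    IsExtremeCone (halfspaceCone W) (halfspaceCone W) where
  subset := subset_rfl
  zero_mem := fun w _ => by simp
  add_mem := fun x hx y hy w hw => by
    rw [inner_add_left]; exact add_nonpos (hx w hw) (hy w hw)
  smul_mem := fun x hx a ha w hw => by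
    rw [real_inner_smul_left]; exact mul_nonpos_of_nonneg_of_nonpos ha (hx w hw)
  left_mem := fun x hx _ _ _ => hx

theorem zero_mem_halfspaceCone (W : Finset V) : (0 : V) ∈ halfspaceCone W :=
  (isExtremeCone_refl W).zero_mem

theorem IsExtremeCone.sum_mem {C F : Set V} (h : IsExtremeCone C F) {ι : Type*} (A : Finset ι)
    (f : ι → V) (hf : ∀ i ∈ A, f i ∈ F) : ∑ i ∈ A, f i ∈ F := by
  classical
  induction A using Finset.induction_on with
  | empty => simpa using h.zero_mem
  | insert a s ha ih =>
    rw [Finset.sum_insert ha]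
    exact h.add_mem _ (hf a (by simp)) _ (ih fun i hi => hf i (by simp [hi]))

theorem IsExtremeCone.trans {C F G : Set V} (hF : IsExtremeCone C F) (hG : IsExtremeCone F G) :
    IsExtremeCone C G where
  subset := hG.subset.trans hF.subset
  zero_mem := hG.zero_mem
  add_mem := hG.add_mem
  smul_mem := hG.smul_mem
  left_mem := fun x hx y hy h => hG.left_mem x (hF.left_mem x hx y hy (hG.subset h)) y
    (hF.left_mem y hy x hx (by rw [add_comm]; exact hG.subset h)) h

theorem IsExtremeCone.mono {C F G : Set V} (hG : IsExtremeCone C G) (hFC : F ⊆ C) (hGF : G ⊆ F) :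
    IsExtremeCone F G where
  subset := hGF
  zero_mem := hG.zero_mem
  add_mem := hG.add_mem
  smul_mem := hG.smul_mem
  left_mem := fun x hx y hy h => hG.left_mem x (hFC hx) y (hFC hy) h

/-- The face of a cone cut out by a valid inequality. -/
theorem isExtremeCone_functional {W : Finset V} {a : V}
    (ha : ∀ x ∈ halfspaceCone W, ⟪x, a⟫ ≤ 0) :
    IsExtremeCone (halfspaceCone W) {x | x ∈ halfspaceCone W ∧ ⟪x, a⟫ = 0} where
  subset := fun x hx => hx.1
  zero_mem := ⟨zero_mem_halfspaceCone W, by simp⟩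
  add_mem := fun x hx y hy =>
    ⟨(isExtremeCone_refl W).add_mem x hx.1 y hy.1, by rw [inner_add_left, hx.2, hy.2, add_zero]⟩
  smul_mem := fun x hx a ha =>
    ⟨(isExtremeCone_refl W).smul_mem x hx.1 a ha, by rw [real_inner_smul_left, hx.2, mul_zero]⟩
  left_mem := fun x hx y hy h => ⟨hx, by
    have h1 := ha x hx
    have h2 := ha y hy
    have h3 := h.2
    rw [inner_add_left] at h3
    linarith⟩

theorem IsFace.isExtremeCone {W : Finset V} {F : Set V} (h : IsFace (halfspaceCone W) F) :
    IsExtremeCone (halfspaceCone W) F := by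
  obtain ⟨l, hl⟩ := h.1 h.2
  have hC := isExtremeCone_refl W
  obtain ⟨p, hp⟩ := h.2
  have hp' := hp
  rw [hl] at hp'
  have hp0 : l p = 0 := by
    have h1 := hp'.2 0 hC.zero_mem
    have h2 := hp'.2 _ (hC.add_mem _ hp'.1 _ hp'.1)
    simp only [map_zero, map_add] at h1 h2
    linarith
  have hneg : ∀ y ∈ halfspaceCone W, l y ≤ 0 := fun y hy => hp0 ▸ hp'.2 y hy
  have hmem : ∀ x, x ∈ F ↔ x ∈ halfspaceCone W ∧ l x = 0 := by
    intro x
    rw [hl]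
    constructor
    · rintro ⟨h1, h2⟩
      exact ⟨h1, le_antisymm (hneg x h1) (hp0 ▸ h2 p hp'.1)⟩
    · rintro ⟨h1, h2⟩
      exact ⟨h1, fun y hy => h2 ▸ hneg y hy⟩
  refine ⟨fun x hx => ((hmem x).1 hx).1, (hmem 0).2 ⟨hC.zero_mem, by simp⟩, ?_, ?_, ?_⟩
  · intro x hx y hy
    rw [hmem] at *
    exact ⟨hC.add_mem x hx.1 y hy.1, by rw [map_add, hx.2, hy.2, add_zero]⟩
  · intro x hx a ha
    rw [hmem] at *
    exact ⟨hC.smul_mem x hx.1 a ha, by rw [map_smul, hx.2, smul_zero]⟩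
  · intro x hx y hy hxy
    rw [hmem] at *
    refine ⟨hx, ?_⟩
    have h1 := hneg x hx
    have h2 := hneg y hy
    have h3 := hxy.2
    rw [map_add] at h3
    linarith

/-- A relative interior point: all inequalities of the cone that are not identically tight on `F`
are strict at it. -/
theorem exists_relint {W : Finset V} {F : Set V} (h : IsExtremeCone (halfspaceCone W) F) :
    ∃ q ∈ F, ∀ w ∈ W, (∀ x ∈ F, ⟪x, w⟫ = 0) ∨ ⟪q, w⟫ < 0 := by
  classical
  have hch : ∀ w : V, ∃ p ∈ F, w ∈ W → (∀ x ∈ F, ⟪x, w⟫ = 0) ∨ ⟪p, w⟫ < 0 := by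
    intro w
    by_cases hw : ∀ x ∈ F, ⟪x, w⟫ = 0
    · exact ⟨0, h.zero_mem, fun _ => Or.inl hw⟩
    · push Not at hw
      obtain ⟨x, hx, hne⟩ := hw
      exact ⟨x, hx, fun hW => Or.inr (lt_of_le_of_ne (h.subset hx w hW) hne)⟩
  choose p hp hpw using hch
  refine ⟨∑ w ∈ W, p w, h.sum_mem _ _ fun w _ => hp w, fun w hw => ?_⟩
  refine (hpw w hw).imp id fun hlt => ?_
  rw [sum_inner]
  refine Finset.sum_neg' (fun v _ => h.subset (hp v) w hw) ⟨w, hw, hlt⟩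

theorem exists_small_add {W : Finset V} {q x : V}
    (h : ∀ w ∈ W, ⟪q, w⟫ < 0 ∨ (⟪q, w⟫ ≤ 0 ∧ ⟪x, w⟫ ≤ 0)) :
    ∃ ε : ℝ, 0 < ε ∧ ∀ w ∈ W, ⟪q + ε • x, w⟫ ≤ 0 := by
  have key : ∀ᶠ ε : ℝ in 𝓝[>] 0, ∀ w ∈ W, ⟪q + ε • x, w⟫ ≤ 0 := by
    rw [Filter.eventually_all_finset]
    intro w hw
    rcases h w hw with h1 | ⟨h1, h2⟩
    · have hc : Continuous fun ε : ℝ => ⟪q + ε • x, w⟫ := by fun_prop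
      have : ∀ᶠ ε : ℝ in 𝓝 0, ⟪q + ε • x, w⟫ < 0 := by
        apply hc.continuousAt.eventually_lt_const
        simpa using h1
      exact (this.filter_mono nhdsWithin_le_nhds).mono fun _ h => h.le
    · filter_upwards [self_mem_nhdsWithin] with ε hε
      rw [inner_add_left, real_inner_smul_left]
      exact add_nonpos h1 (mul_nonpos_of_nonneg_of_nonpos (le_of_lt hε) h2)
  obtain ⟨ε, h1, h2⟩ := (key.and self_mem_nhdsWithin).exists
  exact ⟨ε, h2, h1⟩

/-- If `x` satisfies the equations of `F`, then a relative interior point `q` of `F` can be moved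
slightly along `-x` inside the cone. Thus `q` is the sum of `ε • x` and a point of the cone, and
extremality gives `ε • x ∈ F`. So a face is determined by its tight inequalities. -/
theorem IsExtremeCone.mem_iff {W : Finset V} {F : Set V}
    (h : IsExtremeCone (halfspaceCone W) F) (x : V) :
    x ∈ F ↔ x ∈ halfspaceCone W ∧ ∀ w ∈ W, (∀ y ∈ F, ⟪y, w⟫ = 0) → ⟪x, w⟫ = 0 := by
  refine ⟨fun hx => ⟨h.subset hx, fun w _ hw => hw x hx⟩, fun ⟨hx, hx0⟩ => ?_⟩
  obtain ⟨q, hq, hqw⟩ := exists_relint h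
  obtain ⟨ε, hε, hmem⟩ := exists_small_add (W := W) (q := q) (x := -x) (fun w hw => by
    rcases hqw w hw with h1 | h1
    · right
      rw [inner_neg_left, hx0 w hw h1]
      exact ⟨h.subset hq w hw, by simp⟩
    · exact Or.inl h1)
  have h1 : ε • x ∈ F := by
    refine h.left_mem _ ((isExtremeCone_refl W).smul_mem x hx ε hε.le) (q + ε • -x) hmem ?_
    simpa using hq
  have := h.smul_mem _ h1 ε⁻¹ (inv_nonneg.2 hε.le)
  rwa [smul_smul, inv_mul_cancel₀ hε.ne', one_smul] at this

/-- The sum of the normals that are tight on `F` exposes `F`. The algebraic description makes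
transitivity and restriction of faces immediate. -/
theorem isFace_iff {W : Finset V} {F : Set V} :
    IsFace (halfspaceCone W) F ↔ IsExtremeCone (halfspaceCone W) F := by
  classical
  refine ⟨IsFace.isExtremeCone, fun h => ⟨fun _ => ?_, 0, h.zero_mem⟩⟩
  set A := W.filter fun w => ∀ y ∈ F, ⟪y, w⟫ = 0
  have hl : ∀ x, innerSL ℝ (∑ w ∈ A, w) x = ∑ w ∈ A, ⟪x, w⟫ := by
    intro x
    rw [innerSL_apply_apply, real_inner_comm, inner_sum]
  have hneg : ∀ x ∈ halfspaceCone W, ∀ w ∈ A, ⟪x, w⟫ ≤ 0 := fun x hx w hw =>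
    hx w (Finset.mem_filter.1 hw).1
  refine ⟨innerSL ℝ (∑ w ∈ A, w), Set.ext fun x => ?_⟩
  simp only [hl, Set.mem_ofPred_eq]
  rw [h.mem_iff]
  refine and_congr_right fun hx => ⟨fun h0 y hy => ?_, fun hmax w hw hwF => ?_⟩
  · rw [Finset.sum_eq_zero (f := fun w => ⟪x, w⟫) fun w hw =>
      h0 w (Finset.mem_filter.1 hw).1 (Finset.mem_filter.1 hw).2]
    exact Finset.sum_nonpos fun w hw => hneg y hy w hw
  · have h0 := hmax 0 (zero_mem_halfspaceCone W)
    simp only [inner_zero_left, Finset.sum_const_zero] at h0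
    have h1 := le_antisymm (Finset.sum_nonpos fun w hw => hneg x hx w hw) h0
    exact (Finset.sum_eq_zero_iff_of_nonpos fun w hw => hneg x hx w hw).1 h1 w
      (Finset.mem_filter.2 ⟨hw, hwF⟩)

theorem finite_faces (W : Finset V) : {F | IsFace (halfspaceCone W) F}.Finite := by
  classical
  refine Set.Finite.of_finite_image
    (f := fun F : Set V => W.filter fun w => ∀ y ∈ F, ⟪y, w⟫ = 0) ?_ ?_
  · exact (W.powerset.finite_toSet).subset (by
      rintro _ ⟨F, -, rfl⟩
      exact Finset.mem_coe.2 (Finset.mem_powerset.2 (Finset.filter_subset _ _)))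
  · intro F hF G hG hFG
    rw [Set.mem_ofPred_eq, isFace_iff] at hF hG
    ext x
    rw [hF.mem_iff, hG.mem_iff]
    refine and_congr_right fun _ => forall₂_congr fun w hw => ?_
    have : (∀ y ∈ F, ⟪y, w⟫ = 0) ↔ (∀ y ∈ G, ⟪y, w⟫ = 0) := by
      have := Finset.ext_iff.1 hFG w
      simpa [hw] using this
    rw [this]

/-! ### Pointed rational cones, their rays and induced lattices -/

variable {Λ : Submodule ℤ V}

theorem IsPointedRationalCone.exists_eq {C : Set V} (h : IsPointedRationalCone Λ C) :
    ∃ W : Finset V, (W : Set V) ⊆ Λ ∧ C = halfspaceCone W := h.1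

theorem IsPointedRationalCone.isFace_iff {C F : Set V} (h : IsPointedRationalCone Λ C) :
    IsFace C F ↔ IsExtremeCone C F := by
  obtain ⟨W, -, rfl⟩ := h.exists_eq
  exact LatticeTiling.isFace_iff

theorem IsPointedRationalCone.refl {C : Set V} (h : IsPointedRationalCone Λ C) :
    IsExtremeCone C C := by
  obtain ⟨W, -, rfl⟩ := h.exists_eq
  exact isExtremeCone_refl W

theorem IsPointedRationalCone.isFace_self {C : Set V} (h : IsPointedRationalCone Λ C) :
    IsFace C C := h.isFace_iff.2 h.refl

theorem IsPointedRationalCone.finite_faces {C : Set V} (h : IsPointedRationalCone Λ C) :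
    {F | IsFace C F}.Finite := by
  obtain ⟨W, -, rfl⟩ := h.exists_eq
  exact LatticeTiling.finite_faces W

theorem IsPointedRationalCone.eq_zero_of_neg_mem {C : Set V} (h : IsPointedRationalCone Λ C)
    {x : V} (hx : x ∈ C) (hx' : -x ∈ C) : x = 0 := by
  have := h.2 (Submodule.span ℝ {x}) (by
    intro y hy
    obtain ⟨a, rfl⟩ := Submodule.mem_span_singleton.1 hy
    rcases le_total 0 a with ha | ha
    · exact h.refl.smul_mem x hx a ha
    · have := h.refl.smul_mem _ hx' (-a) (by linarith)
      simpa using this)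
  simpa using this

theorem IsPointedRationalCone.face {C F : Set V} (h : IsPointedRationalCone Λ C)
    (hF : IsFace C F) : IsPointedRationalCone Λ F := by
  classical
  have hF' := h.isFace_iff.1 hF
  obtain ⟨W, hW, rfl⟩ := h.exists_eq
  refine ⟨⟨W ∪ (W.filter fun w => ∀ y ∈ F, ⟪y, w⟫ = 0).image fun w => -w, ?_, ?_⟩,
    fun U hU => h.2 U (hU.trans hF'.subset)⟩
  · intro x hx
    simp only [Finset.coe_union, Finset.coe_image, Finset.coe_filter, Set.mem_union, Finset.mem_coe,
      Set.mem_image, Set.mem_ofPred_eq] at hx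
    rcases hx with hx | ⟨w, ⟨hw, -⟩, rfl⟩
    · exact hW hx
    · exact Λ.neg_mem (hW hw)
  · ext x
    rw [hF'.mem_iff]
    simp only [Finset.mem_union, Finset.mem_image, Finset.mem_filter, Set.mem_ofPred_eq]
    constructor
    · rintro ⟨h1, h2⟩ w (hw | ⟨w, ⟨hw, hwF⟩, rfl⟩)
      · exact h1 w hw
      · rw [inner_neg_right, h2 w hw hwF, neg_zero]
    · intro hx
      refine ⟨fun w hw => hx w (Or.inl hw), fun w hw hwF => le_antisymm (hx w (Or.inl hw)) ?_⟩
      have := hx (-w) (Or.inr ⟨w, ⟨hw, hwF⟩, rfl⟩)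
      rw [inner_neg_right] at this
      linarith

theorem IsPointedRationalCone.isFace_zero {C : Set V} (h : IsPointedRationalCone Λ C) :
    IsFace C {0} := by
  rw [h.isFace_iff]
  refine ⟨by simpa using h.refl.zero_mem, rfl, by simp, by simp, ?_⟩
  intro x hx y hy hxy
  have : y = -x := by rw [Set.mem_singleton_iff] at hxy; exact eq_neg_of_add_eq_zero_right hxy
  exact h.eq_zero_of_neg_mem hx (this ▸ hy)

theorem IsFace.subset {P F : Set V} (h : IsFace P F) : F ⊆ P := h.1.subset

theorem IsPointedRationalCone.face_trans {C F G : Set V} (h : IsPointedRationalCone Λ C)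
    (hF : IsFace C F) (hG : IsFace F G) : IsFace C G :=
  h.isFace_iff.2 ((h.isFace_iff.1 hF).trans ((h.face hF).isFace_iff.1 hG))

theorem IsPointedRationalCone.face_mono {C F G : Set V} (h : IsPointedRationalCone Λ C)
    (hF : IsFace C F) (hG : IsFace C G) (hGF : G ⊆ F) : IsFace F G :=
  (h.face hF).isFace_iff.2 ((h.isFace_iff.1 hG).mono hF.subset hGF)

/-- Moving from `x` in direction `-u`, one stays in `C` until the first inequality that is strict at
`u` becomes tight; pointedness provides such an inequality. The face it cuts out is proper because
it misses `u`. -/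
theorem IsPointedRationalCone.exists_sub_mem_face {C : Set V} (h : IsPointedRationalCone Λ C)
    {u x : V} (hu : u ∈ C) (hu0 : u ≠ 0) (hx : x ∈ C) :
    ∃ s : ℝ, 0 ≤ s ∧ ∃ F, IsProperFace C F ∧ x - s • u ∈ F := by
  classical
  have hr := h
  obtain ⟨W, hW, rfl⟩ := h.exists_eq
  set A := W.filter fun w => ⟪u, w⟫ < 0
  have hA : A.Nonempty := by
    by_contra hA
    rw [Finset.not_nonempty_iff_eq_empty, Finset.filter_eq_empty_iff] at hA
    refine hu0 (hr.eq_zero_of_neg_mem hu fun w hw => ?_)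
    rw [inner_neg_left]
    linarith [not_lt.1 (hA hw)]
  obtain ⟨w₀, hw₀, hmin⟩ := A.exists_min_image (fun w => ⟪x, w⟫ / ⟪u, w⟫) hA
  obtain ⟨hw₀W, hw₀u⟩ := Finset.mem_filter.1 hw₀
  set s := ⟪x, w₀⟫ / ⟪u, w₀⟫ with hs
  have hs0 : 0 ≤ s := div_nonneg_of_nonpos (hx w₀ hw₀W) hw₀u.le
  have hface := isExtremeCone_functional (W := W) (a := w₀) fun x hx => hx w₀ hw₀W
  refine ⟨s, hs0, _, ⟨hr.isFace_iff.2 hface, fun heq => ?_⟩, ?_, ?_⟩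
  · have := heq.symm ▸ hu
    exact hw₀u.ne this.2
  · intro w hw
    rw [inner_sub_left, real_inner_smul_left]
    by_cases hwu : ⟪u, w⟫ < 0
    · have := hmin w (Finset.mem_filter.2 ⟨hw, hwu⟩)
      rw [le_div_iff_of_neg hwu] at this
      linarith
    · have h1 : ⟪u, w⟫ = 0 := le_antisymm (hu w hw) (not_lt.1 hwu)
      rw [h1, mul_zero, sub_zero]
      exact hx w hw
  · rw [inner_sub_left, real_inner_smul_left, hs, div_mul_cancel₀ _ hw₀u.ne, sub_self]

theorem IsRay.exists_ne_zero {C M : Set V} (h : IsRay C M) : ∃ m ∈ M, m ≠ 0 := by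
  by_contra hcon
  push Not at hcon
  have : Submodule.span ℝ M = ⊥ := Submodule.span_eq_bot.2 hcon
  have h2 := h.2
  rw [this, finrank_bot] at h2
  exact zero_ne_one h2

theorem IsPointedRationalCone.exists_generator {C M : Set V} (h : IsPointedRationalCone Λ C)
    (hM : IsRay C M) : ∃ m : V, ‖m‖ = 1 ∧ M = {x | ∃ a : ℝ, 0 ≤ a ∧ x = a • m} := by
  have hMC := h.isFace_iff.1 hM.1
  obtain ⟨m, hm, hm0⟩ := hM.exists_ne_zero
  have hn : 0 < ‖m‖ := norm_pos_iff.2 hm0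
  refine ⟨‖m‖⁻¹ • m, by rw [norm_smul, norm_inv, norm_norm, inv_mul_cancel₀ hn.ne'], ?_⟩
  ext x
  constructor
  · intro hx
    obtain ⟨a, ha⟩ := exists_smul_eq_of_finrank_eq_one hM.2
      (x := (⟨m, Submodule.subset_span hm⟩ : Submodule.span ℝ M))
      (by simpa [Subtype.ext_iff] using hm0) ⟨x, Submodule.subset_span hx⟩
    have hax : a • m = x := congrArg Subtype.val ha
    have ha0 : 0 ≤ a := by
      by_contra hneg
      push Not at hneg
      refine hm0 (h.eq_zero_of_neg_mem (hMC.subset hm) (hMC.subset ?_))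
      have := hMC.smul_mem x hx (-a)⁻¹ (inv_nonneg.2 (by linarith))
      rwa [← hax, smul_smul, inv_neg, neg_mul, inv_mul_cancel₀ hneg.ne, neg_smul, one_smul] at this
    exact ⟨a * ‖m‖, by positivity, by rw [smul_smul, mul_assoc, mul_inv_cancel₀ hn.ne', mul_one, hax]⟩
  · rintro ⟨a, ha, rfl⟩
    rw [smul_smul]
    exact hMC.smul_mem m hm _ (by positivity)

theorem IsPointedRationalCone.interior_polar_ray {C M : Set V} (h : IsPointedRationalCone Λ C)
    (hM : IsRay C M) {m : V} (hm : m ∈ M) (hm0 : m ≠ 0) :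
    interior (polar M) = {x | ⟪x, m⟫ < 0} := by
  obtain ⟨m', hm'1, rfl⟩ := h.exists_generator hM
  obtain ⟨a, ha, rfl⟩ := hm
  have ha' : 0 < a := lt_of_le_of_ne ha (by rintro rfl; simp at hm0)
  apply Set.Subset.antisymm
  · intro x hx
    have hc : Continuous fun ε : ℝ => x + ε • m' := by fun_prop
    have h0 : ∀ᶠ ε : ℝ in 𝓝[>] 0, x + ε • m' ∈ polar {x | ∃ a : ℝ, 0 ≤ a ∧ x = a • m'} := by
      refine Filter.Eventually.filter_mono nhdsWithin_le_nhds ?_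
      refine hc.continuousAt.eventually_mem (mem_interior_iff_mem_nhds.1 ?_)
      simpa using hx
    obtain ⟨ε, h1, h2⟩ := (h0.and self_mem_nhdsWithin).exists
    have h3 := h1 (a • m') ⟨a, ha, rfl⟩
    rw [Set.mem_ofPred_eq]
    rw [inner_add_left, real_inner_smul_left, real_inner_smul_right m',
      real_inner_self_eq_norm_sq, hm'1] at h3
    have : 0 < ε * (a * 1 ^ 2) := by
      have : 0 < ε := h2
      positivity
    linarith
  · refine interior_maximal ?_ (isOpen_lt (by fun_prop) continuous_const)
    rintro x hx _ ⟨b, hb, rfl⟩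
    rw [Set.mem_ofPred_eq, real_inner_smul_right] at hx
    rw [real_inner_smul_right]
    exact mul_nonpos_of_nonneg_of_nonpos hb (neg_of_mul_neg_right hx ha).le

theorem mem_orth_iff {C : Set V} {x : V} : x ∈ orth C ↔ ∀ y ∈ C, ⟪x, y⟫ = 0 := by
  rw [orth, Submodule.mem_orthogonal']
  refine ⟨fun h y hy => h y (Submodule.subset_span hy), fun h y hy => ?_⟩
  induction hy using Submodule.span_induction with
  | mem y hy => exact h y hy
  | zero => simp
  | add a b _ _ ha hb => rw [inner_add_right, ha, hb, add_zero]
  | smul c a _ ha => rw [real_inner_smul_right, ha, mul_zero]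

theorem mem_inducedLattice_iff {C : Set V} {x : V} :
    x ∈ inducedLattice Λ C ↔ x ∈ Λ ∧ ∀ y ∈ C, ⟪x, y⟫ = 0 := by
  rw [inducedLattice, Submodule.mem_inf, Submodule.restrictScalars_mem, mem_orth_iff]

theorem inducedLattice_mono {K C : Set V} (h : K ⊆ C) :
    inducedLattice Λ C ≤ inducedLattice Λ K := by
  intro x hx
  rw [mem_inducedLattice_iff] at *
  exact ⟨hx.1, fun y hy => hx.2 y (h hy)⟩

variable [FiniteDimensional ℝ V]

theorem IsPointedRationalCone.exists_isRay {C : Set V} (h : IsPointedRationalCone Λ C)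
    (hC : C ≠ {0}) : ∃ M, IsRay C M := by
  induction hn : Module.finrank ℝ (vectorSpan ℝ C) using Nat.strong_induction_on generalizing C with
  | _ n ih =>
  subst hn
  by_cases hex : ∃ F, IsProperFace C F ∧ F ≠ {0}
  · obtain ⟨F, hF, hF0⟩ := hex
    obtain ⟨M, hM⟩ := ih _ hF.finrank_lt (h.face hF.1) hF0 rfl
    exact ⟨M, h.face_trans hF.1 hM.1, hM.2⟩
  · push Not at hex
    obtain ⟨u, hu, hu0⟩ : ∃ u ∈ C, u ≠ 0 := by
      by_contra hcon
      push Not at hcon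
      exact hC (Set.Subset.antisymm (fun x hx => hcon x hx) (by simpa using h.refl.zero_mem))
    refine ⟨C, h.isFace_self, ?_⟩
    have : Submodule.span ℝ C = Submodule.span ℝ {u} := by
      refine le_antisymm (Submodule.span_le.2 fun x hx => ?_)
        (Submodule.span_mono (by simpa using hu))
      obtain ⟨s, -, F, hF, hxF⟩ := h.exists_sub_mem_face hu hu0 hx
      rw [hex F hF, Set.mem_singleton_iff, sub_eq_zero] at hxF
      exact Submodule.mem_span_singleton.2 ⟨s, hxF.symm⟩
    rw [this, finrank_span_singleton hu0]

/-- A pointed cone is generated by its rays. -/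
theorem IsPointedRationalCone.subset_of_rays {C : Set V} (h : IsPointedRationalCone Λ C)
    (A : AddSubmonoid V) (hA : ∀ M, IsRay C M → M ⊆ A) : C ⊆ A := by
  induction hn : Module.finrank ℝ (vectorSpan ℝ C) using Nat.strong_induction_on generalizing C with
  | _ n ih =>
  subst hn
  by_cases hC : C = {0}
  · rw [hC]
    simp
  obtain ⟨M, hM⟩ := h.exists_isRay hC
  obtain ⟨u, hu, hu0⟩ := hM.exists_ne_zero
  have hMC := h.isFace_iff.1 hM.1
  intro x hx
  obtain ⟨s, hs, F, hF, hxF⟩ := h.exists_sub_mem_face (hMC.subset hu) hu0 hx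
  have h1 := ih _ hF.finrank_lt (h.face hF.1)
    (fun M' hM' => hA M' ⟨h.face_trans hF.1 hM'.1, hM'.2⟩) rfl hxF
  have h2 := A.add_mem h1 (hA M hM (hMC.smul_mem u hu s hs))
  simpa using h2

theorem IsPointedRationalCone.exists_isRay_not_subset {C K K' : Set V}
    (h : IsPointedRationalCone Λ C) (hK : IsFace C K) (hK' : IsFace C K') (hKK' : ¬ K' ⊆ K) :
    ∃ M, IsRay C M ∧ M ⊆ K' ∧ ¬ M ⊆ K := by
  by_contra hcon
  push Not at hcon
  have hKe := h.isFace_iff.1 hK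
  refine hKK' ((h.face hK').subset_of_rays
    ⟨⟨K, fun {a b} ha hb => hKe.add_mem a ha b hb⟩, hKe.zero_mem⟩ fun M hM => ?_)
  exact hcon M ⟨h.face_trans hK' hM.1, hM.2⟩ hM.1.subset

theorem IsPointedRationalCone.mem_polar_of_rays {C : Set V} (h : IsPointedRationalCone Λ C) {z : V}
    (hz : ∀ M, IsRay C M → ∀ m ∈ M, ⟪z, m⟫ ≤ 0) : z ∈ polar C := by
  intro y hy
  refine h.subset_of_rays
    ⟨⟨{y | ⟪z, y⟫ ≤ 0}, fun {a b} ha hb => ?_⟩, by simp⟩ (fun M hM m hm => hz M hM m hm) hy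
  simp only [Set.mem_ofPred_eq, inner_add_right] at *
  exact add_nonpos ha hb

/-- The linear hull of the induced lattice of a rational cone is the orthogonal space. -/
theorem IsPointedRationalCone.span_inducedLattice {C : Set V} (h : IsPointedRationalCone Λ C) :
    Submodule.span ℝ (inducedLattice Λ C : Set V) = orth C := by
  classical
  apply le_antisymm
  · exact Submodule.span_le.2 fun x hx => mem_orth_iff.2 (mem_inducedLattice_iff.1 hx).2
  obtain ⟨W, hW, rfl⟩ := h.exists_eq
  obtain ⟨q, hq, hqw⟩ := exists_relint (isExtremeCone_refl W)
  rw [orth, ← Submodule.orthogonal_orthogonal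
    (Submodule.span ℝ (inducedLattice Λ (halfspaceCone W) : Set V))]
  apply Submodule.orthogonal_le
  intro y hy
  -- Rationality enters here: the identically tight normals `w` are themselves elements of `L(C)`. A
  -- vector `y` orthogonal to `L(C)` therefore keeps `q + ε • y` in the cone, so `y` lies in the
  -- span of the cone.
  have hy' : ∀ w ∈ W, (∀ x ∈ halfspaceCone W, ⟪x, w⟫ = 0) → ⟪y, w⟫ = 0 := by
    intro w hw hw0
    refine (Submodule.mem_orthogonal' _ _).1 hy w (Submodule.subset_span ?_)
    exact mem_inducedLattice_iff.2 ⟨hW hw, fun x hx => by rw [real_inner_comm]; exact hw0 x hx⟩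
  obtain ⟨ε, hε, hmem⟩ := exists_small_add (W := W) (q := q) (x := y) (fun w hw => by
    rcases hqw w hw with h1 | h1
    · exact Or.inr ⟨hq w hw, (hy' w hw h1).le⟩
    · exact Or.inl h1)
  have h1 : ε • y ∈ Submodule.span ℝ (halfspaceCone W) := by
    have := Submodule.sub_mem _ (Submodule.subset_span (R := ℝ) (s := halfspaceCone W) hmem)
      (Submodule.subset_span hq)
    simpa using this
  have := Submodule.smul_mem _ ε⁻¹ h1
  rwa [smul_smul, inv_mul_cancel₀ hε.ne', one_smul] at this

end Cones

/-! ### Translation sets, and how they depend on the cone -/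

section Regions

variable {V : Type*} [NormedAddCommGroup V] [InnerProductSpace ℝ V]

theorem mem_vadd_iff {E : Type*} [AddCommGroup E] {D : Set E} {x z : E} : z ∈ x +ᵥ D ↔ z - x ∈ D := by
  rw [Set.mem_vadd_set_iff_neg_vadd_mem, vadd_eq_add, neg_add_eq_sub]

theorem mem_coveringComplex_iff {E : Type*} [NormedAddCommGroup E] {Λ : Submodule ℤ E}
    {D Q : Set E} {z : E} :
    z ∈ coveringComplex Λ D Q ↔ ∃ y ∈ Λ, z - y ∈ D ∧ ∃ q ∈ Q, q - y ∈ D := by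
  simp only [coveringComplex, Set.mem_iUnion, Set.mem_ofPred_eq, exists_prop, mem_vadd_iff,
    Set.Nonempty, Set.mem_inter_iff]
  constructor
  · rintro ⟨y, ⟨hy, q, hq1, hq2⟩, hz⟩
    exact ⟨y, hy, hz, q, hq2, hq1⟩
  · rintro ⟨y, hy, hz, q, hq2, hq1⟩
    exact ⟨y, ⟨hy, q, hq1, hq2⟩, hz⟩

theorem coveringComplex_mono {E : Type*} [NormedAddCommGroup E] {Λ : Submodule ℤ E}
    {D Q Q' : Set E} (h : Q ⊆ Q') :
    coveringComplex Λ D Q ⊆ coveringComplex Λ D Q' := by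
  intro z hz
  rw [mem_coveringComplex_iff] at *
  obtain ⟨y, hy, hz, q, hq, hqy⟩ := hz
  exact ⟨y, hy, hz, q, h hq, hqy⟩

theorem polar_anti {K C : Set V} (h : K ⊆ C) : polar C ⊆ polar K := fun _ hx y hy => hx y (h hy)

open Classical in
/-- The translation vectors of `G` relative to `K` saturated by the induced lattice of `K`. -/
noncomputable def latticeTranslationSet (Λ : Submodule ℤ V) (R : Set V → Set V) (G K : Set V) :
    Set V :=
  if G = K then inducedLattice Λ K else translationSet Λ R G K

variable {Λ : Submodule ℤ V} {R : Set V → Set V}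

theorem latticeTranslationSet_self {K : Set V} :
    latticeTranslationSet Λ R K K = inducedLattice Λ K := if_pos rfl

theorem latticeTranslationSet_of_ne {G K : Set V} (h : G ≠ K) :
    latticeTranslationSet Λ R G K = translationSet Λ R G K := if_neg h

theorem translationSet_self {K : Set V} : translationSet Λ R K K = {0} := if_pos rfl

theorem mem_translationSet_iff {K C : Set V} (h : K ≠ C) {x : V} :
    x ∈ translationSet Λ R K C ↔ x ∈ inducedLattice Λ K ∧
      (∀ M, IsRay C M → ¬ M ⊆ K → x +ᵥ R K ⊆ interior (polar M)) ∧
      (∀ K', IsProperFace C K' → ¬ K ⊆ K' → ¬ K' ⊆ K →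
        ∀ x' ∈ inducedLattice Λ K', Disjoint (x +ᵥ R K) (x' +ᵥ R K')) := by
  rw [translationSet, if_neg h]
  rfl

theorem translationSet_subset_inducedLattice {K C : Set V} {x : V}
    (h : x ∈ translationSet Λ R K C) : x ∈ inducedLattice Λ K := by
  by_cases hKC : K = C
  · subst hKC
    rw [translationSet_self, Set.mem_singleton_iff] at h
    rw [h]
    exact zero_mem _
  · exact ((mem_translationSet_iff hKC).1 h).1

theorem latticeTranslationSet_subset_inducedLattice {K C : Set V} {x : V}
    (h : x ∈ latticeTranslationSet Λ R K C) : x ∈ inducedLattice Λ K := by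
  by_cases hKC : K = C
  · subst hKC
    rwa [latticeTranslationSet_self] at h
  · rw [latticeTranslationSet_of_ne hKC] at h
    exact translationSet_subset_inducedLattice h

theorem inner_neg_of_mem_translationSet {K C M : Set V} (hC : IsPointedRationalCone Λ C)
    (hKC : K ≠ C) {x z m : V} (hx : x ∈ translationSet Λ R K C) (hz : z - x ∈ R K)
    (hM : IsRay C M) (hMK : ¬ M ⊆ K) (hm : m ∈ M) (hm0 : m ≠ 0) : ⟪z, m⟫ < 0 := by
  have := ((mem_translationSet_iff hKC).1 hx).2.1 M hM hMK (mem_vadd_iff.2 hz)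
  rwa [hC.interior_polar_ray hM hm hm0] at this

theorem IsRay.face_mono {C K M : Set V} (hC : IsPointedRationalCone Λ C) (hK : IsFace C K)
    (hM : IsRay C M) (hMK : M ⊆ K) : IsRay K M := ⟨hC.face_mono hK hM.1 hMK, hM.2⟩

theorem IsRay.face_trans {C K M : Set V} (hC : IsPointedRationalCone Λ C) (hK : IsFace C K)
    (hM : IsRay K M) : IsRay C M := ⟨hC.face_trans hK hM.1, hM.2⟩

/-- A shift by `a ∈ L(K)` changes no inner product with a ray of `K`, and it permutes `L(K')` for
each face `K'` of `K`; so both defining conditions are invariant. -/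
theorem add_mem_latticeTranslationSet {G K : Set V} (hK : IsPointedRationalCone Λ K)
    (hG : IsFace K G) {x a : V} (hx : x ∈ latticeTranslationSet Λ R G K)
    (ha : a ∈ inducedLattice Λ K) : x + a ∈ latticeTranslationSet Λ R G K := by
  by_cases hGK : G = K
  · subst hGK
    rw [latticeTranslationSet_self] at *
    exact add_mem hx ha
  rw [latticeTranslationSet_of_ne hGK] at *
  have hx' := (mem_translationSet_iff hGK).1 hx
  refine (mem_translationSet_iff hGK).2
    ⟨add_mem hx'.1 (inducedLattice_mono hG.subset ha), fun M hM hMG z hz => ?_,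
      fun K' hK' h1 h2 x' hx'' => ?_⟩
  · obtain ⟨m, hm, hm0⟩ := hM.exists_ne_zero
    rw [hK.interior_polar_ray hM hm hm0]
    rw [mem_vadd_iff] at hz
    have := inner_neg_of_mem_translationSet (z := z - a) hK hGK hx
      (by rwa [sub_sub, add_comm a]) hM hMG hm hm0
    rwa [inner_sub_left, (mem_inducedLattice_iff.1 ha).2 m (hM.1.subset hm), sub_zero] at this
  · rw [Set.disjoint_left]
    intro z hz hz'
    rw [mem_vadd_iff] at hz hz'
    have hd := hx'.2.2 K' hK' h1 h2 (x' - a)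
      (sub_mem hx'' (inducedLattice_mono hK'.1.subset ha))
    have h1 : z - a ∈ x +ᵥ R G := by rwa [mem_vadd_iff, sub_sub, add_comm a]
    have h2 : z - a ∈ (x' - a) +ᵥ R K' := by rwa [mem_vadd_iff, sub_sub_sub_cancel_right]
    exact Set.disjoint_left.1 hd h1 h2

/-- Rays and faces of `K` are rays and faces of `C`, so `K` imposes fewer conditions. -/
theorem translationSet_subset_face {G K C : Set V} (hC : IsPointedRationalCone Λ C)
    (hK : IsFace C K) (hG : IsFace K G) {x : V} (hx : x ∈ translationSet Λ R G C) :
    x ∈ latticeTranslationSet Λ R G K := by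
  by_cases hGK : G = K
  · subst hGK
    rw [latticeTranslationSet_self]
    exact translationSet_subset_inducedLattice hx
  have hGC : G ≠ C := by
    rintro rfl
    exact hGK (Set.Subset.antisymm hG.subset hK.subset)
  rw [latticeTranslationSet_of_ne hGK, mem_translationSet_iff hGK]
  rw [mem_translationSet_iff hGC] at hx
  refine ⟨hx.1, fun M hM => hx.2.1 M (hM.face_trans hC hK), fun K' hK' => hx.2.2 K'
    ⟨hC.face_trans hK hK'.1, ?_⟩⟩
  rintro rfl
  exact hK'.2 (Set.Subset.antisymm hK'.1.subset hK.subset)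

theorem mem_inducedLattice_zero {x : V} : x ∈ inducedLattice Λ {0} ↔ x ∈ Λ := by
  rw [mem_inducedLattice_iff]
  simp

theorem eq_zero_of_mem_span_of_mem_orth {C : Set V} {z : V} (h : z ∈ Submodule.span ℝ C)
    (h' : z ∈ orth C) : z = 0 :=
  inner_self_eq_zero.1 ((Submodule.mem_orthogonal _ _).1 h' z h)

theorem sub_mem_coveringComplex_polar {C : Set V} {D : Set V} {z a : V}
    (hz : z ∈ coveringComplex Λ D (polar C)) (ha : a ∈ inducedLattice Λ C) :
    z - a ∈ coveringComplex Λ D (polar C) := by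
  rw [mem_inducedLattice_iff] at ha
  rw [mem_coveringComplex_iff] at *
  obtain ⟨y, hy, hzy, q, hq, hqy⟩ := hz
  refine ⟨y - a, sub_mem hy ha.1, by rwa [sub_sub_sub_cancel_right], q - a, fun c hc => ?_,
    by rwa [sub_sub_sub_cancel_right]⟩
  rw [inner_sub_left, ha.2 c hc, sub_zero]
  exact hq c hc

theorem IsPointedRationalCone.eq_zero_of_isProperFace_ray {M G : Set V} {C : Set V}
    (hC : IsPointedRationalCone Λ C) (hM : IsRay C M) (hG : IsProperFace M G) : G = {0} := by
  have hMr := hC.face hM.1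
  have hGe := hMr.isFace_iff.1 hG.1
  obtain ⟨m, -, rfl⟩ := hC.exists_generator hM
  refine Set.Subset.antisymm (fun g hg => ?_) (by simpa using hGe.zero_mem)
  obtain ⟨a, ha, rfl⟩ := hG.1.subset hg
  rcases ha.eq_or_lt with rfl | ha
  · simp
  · refine absurd (Set.Subset.antisymm hG.1.subset ?_) hG.2
    rintro _ ⟨b, hb, rfl⟩
    have := hGe.smul_mem _ hg (b / a) (by positivity)
    rwa [smul_smul, div_mul_cancel₀ _ ha.ne'] at this

variable [FiniteDimensional ℝ V] {T : Set V → Set V}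

/-- A translation vector of `G` relative to a face `K` of `C` is one relative to `C`, provided the
translate contains a point that is far inside the facets of `polar C` not containing `K`. -/
theorem mem_translationSet_of_far {G K C : Set V} (hC : IsPointedRationalCone Λ C)
    (hK : IsFace C K) (hG : IsFace K G) (hGC : G ≠ C) {ρ : ℝ}
    (hρ : ∀ F, IsProperFace C F → ∀ a ∈ R F, ‖a‖ ≤ ρ) {x z : V}
    (hx : x ∈ latticeTranslationSet Λ R G K) (hz : z - x ∈ R G)
    (hfar : ∀ M, IsRay C M → ¬ M ⊆ K → ∀ m ∈ M, m ≠ 0 → ⟪z, m⟫ < -(3 * ρ) * ‖m‖) :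
    x ∈ translationSet Λ R G C := by
  have hGC' : IsProperFace C G := ⟨hC.face_trans hK hG, hGC⟩
  have hρ0 : 0 ≤ ρ := (norm_nonneg _).trans (hρ G hGC' _ hz)
  -- The margin `3ρ` is spent as follows: `2ρ` bounds the diameter of `x + R(G)`, and the last `ρ`
  -- separates it from any `x' + R(K')` with `x'` orthogonal to the ray `m`.
  have hclose : ∀ w, w - x ∈ R G → ∀ m : V, ⟪w, m⟫ ≤ ⟪z, m⟫ + 2 * ρ * ‖m‖ := by
    intro w hw m
    have h1 := hρ G hGC' _ hz
    have h2 := hρ G hGC' _ hw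
    have h3 : ‖w - z‖ ≤ 2 * ρ := by
      have := norm_sub_le (w - x) (z - x)
      rw [sub_sub_sub_cancel_right] at this
      linarith
    have h4 := (real_inner_le_norm (w - z) m).trans
      (mul_le_mul_of_nonneg_right h3 (norm_nonneg m))
    rw [inner_sub_left] at h4
    linarith
  rw [mem_translationSet_iff hGC]
  refine ⟨latticeTranslationSet_subset_inducedLattice hx, fun M hM hMG w hw => ?_,
    fun K' hK' h1 h2 x' hx' => ?_⟩
  · obtain ⟨m, hm, hm0⟩ := hM.exists_ne_zero
    rw [hC.interior_polar_ray hM hm hm0]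
    rw [mem_vadd_iff] at hw
    by_cases hMK : M ⊆ K
    · have hGK : G ≠ K := by
        rintro rfl
        exact hMG hMK
      rw [latticeTranslationSet_of_ne hGK] at hx
      exact inner_neg_of_mem_translationSet (hC.face hK) hGK hx hw (hM.face_mono hC hK hMK) hMG
        hm hm0
    · have h1 := hfar M hM hMK m hm hm0
      have h2 := hclose w hw m
      have h3 : 0 ≤ ρ * ‖m‖ := by positivity
      rw [Set.mem_ofPred_eq]
      linarith
  · by_cases hKK' : K' ⊆ K
    · have hGK : G ≠ K := by
        rintro rfl
        exact h2 hKK'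
      rw [latticeTranslationSet_of_ne hGK, mem_translationSet_iff hGK] at hx
      refine hx.2.2 K' ⟨hC.face_mono hK hK'.1 hKK', ?_⟩ h1 h2 x' hx'
      rintro rfl
      exact h1 hG.subset
    · obtain ⟨M, hM, hMK', hMK⟩ := hC.exists_isRay_not_subset hK hK'.1 hKK'
      obtain ⟨m, hm, hm0⟩ := hM.exists_ne_zero
      rw [Set.disjoint_left]
      intro w hw hw'
      rw [mem_vadd_iff] at hw hw'
      have h1 := hfar M hM hMK m hm hm0
      have h2 := hclose w hw m
      have h3 := (neg_le_abs _).trans ((abs_real_inner_le_norm (w - x') m).trans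
        (mul_le_mul_of_nonneg_right (hρ K' hK' _ hw') (norm_nonneg m)))
      rw [inner_sub_left, (mem_inducedLattice_iff.1 hx').2 m (hMK' hm)] at h3
      linarith

theorem region_zero : region Λ T {0} = T {0} := by
  rw [region_eq, regionStep, if_pos rfl]

theorem region_of_ne {C : Set V} (h : C ≠ {0}) : region Λ T C =
    (⋃ K ∈ {K | IsProperFace C K}, translationSet Λ (region Λ T) K C + region Λ T K)ᶜ ∩
      (T C + (Submodule.span ℝ C : Set V)) ∩ coveringComplex Λ (T {0}) (polar C) := by
  rw [region_eq, regionStep, if_neg h]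

theorem region_subset_coveringComplex {C : Set V} : region Λ T C ⊆ coveringComplex Λ (T {0}) (polar C) := by
  by_cases h : C = {0}
  · subst h
    rw [region_zero]
    intro z hz
    exact mem_coveringComplex_iff.2 ⟨0, zero_mem _, by simpa using hz, z,
      fun y hy => by rw [Set.mem_singleton_iff.1 hy, inner_zero_right], by simpa using hz⟩
  · rw [region_of_ne h]
    exact Set.inter_subset_right

theorem exists_sub_mem_span_of_mem_region {C : Set V} {z : V} (hz : z ∈ region Λ T C) :
    ∃ a ∈ T C, z - a ∈ Submodule.span ℝ C := by
  by_cases h : C = {0}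
  · subst h
    rw [region_zero] at hz
    exact ⟨z, hz, by simp⟩
  · rw [region_of_ne h] at hz
    obtain ⟨a, ha, c, hc, rfl⟩ := hz.1.2
    exact ⟨a, ha, by simpa using hc⟩

theorem not_mem_region_of_mem_translate {C K : Set V} (hK : IsProperFace C K) {x z : V}
    (hz : z ∈ region Λ T C) (hx : x ∈ translationSet Λ (region Λ T) K C) :
    z - x ∉ region Λ T K := by
  intro hzx
  by_cases h : C = {0}
  · subst h
    obtain ⟨y, hy⟩ := hK.1.2
    have hy0 := hK.1.subset hy
    rw [Set.mem_singleton_iff] at hy0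
    exact hK.2 (Set.Subset.antisymm hK.1.subset (by simpa [hy0] using hy))
  · rw [region_of_ne h] at hz
    refine hz.1.1 (Set.mem_biUnion (x := K) hK ⟨x, hx, _, hzx, by simp⟩)

/-- No point of a translate of a bigger region lies in an admissible translate of a smaller one. -/
theorem not_mem_of_isProperFace {C K K' : Set V} (hC : IsPointedRationalCone Λ C)
    (hK' : IsFace C K') (hK : IsProperFace K' K) {x x' z : V}
    (hx : x ∈ translationSet Λ (region Λ T) K C) (hx' : x' ∈ inducedLattice Λ K')
    (hz : z - x ∈ region Λ T K) : z - x' ∉ region Λ T K' := by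
  intro hz'
  have h1 := translationSet_subset_face hC hK' hK.1 hx
  have h2 := add_mem_latticeTranslationSet (hC.face hK') hK.1 h1 (neg_mem hx')
  rw [latticeTranslationSet_of_ne hK.2] at h2
  refine not_mem_region_of_mem_translate hK hz' h2 ?_
  convert hz using 1
  abel

/-! ### The tiling of the covering complex of a polar cone -/

variable [MeasurableSpace V] [BorelSpace V]

/-- A choice of fundamental domains for the induced lattices of all pointed rational cones. -/
def IsDomainChoice (Λ : Submodule ℤ V) (T : Set V → Set V) : Prop :=
  ∀ C : Set V, IsPointedRationalCone Λ C → IsFundamentalDomain (inducedLattice Λ C) (T C)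

theorem IsDomainChoice.exists_sub_mem (hT : IsDomainChoice Λ T) {C : Set V}
    (hC : IsPointedRationalCone Λ C) {z : V} (hz : z ∈ orth C) :
    ∃ y ∈ inducedLattice Λ C, z - y ∈ T C := by
  rw [← hC.span_inducedLattice] at hz
  obtain ⟨⟨y, hy⟩, h⟩ := Set.mem_iUnion.1 ((hT C hC).tiling.2.1 hz)
  exact ⟨y, hy, mem_vadd_iff.1 h⟩

theorem IsDomainChoice.unique (hT : IsDomainChoice Λ T) {C : Set V}
    (hC : IsPointedRationalCone Λ C) {x y z : V} (hx : x ∈ inducedLattice Λ C)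
    (hy : y ∈ inducedLattice Λ C) (hzx : z - x ∈ T C) (hzy : z - y ∈ T C) : x = y := by
  by_contra hne
  exact Set.disjoint_left.1 ((hT C hC).tiling.2.2 ⟨x, hx⟩ ⟨y, hy⟩ (by simpa using hne))
    (mem_vadd_iff.2 hzx) (mem_vadd_iff.2 hzy)

theorem IsDomainChoice.mem_orth (hT : IsDomainChoice Λ T) {C : Set V}
    (hC : IsPointedRationalCone Λ C) {a : V} (ha : a ∈ T C) : a ∈ orth C := by
  rw [← hC.span_inducedLattice]
  exact (hT C hC).subset_lin ha

/-- The region lies over `T(K)` with respect to the orthogonal projection to `K^⊥`, and translates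
of `T(K)` by `L(K)` are disjoint. -/
theorem region_translate_unique (hT : IsDomainChoice Λ T) {K : Set V}
    (hK : IsPointedRationalCone Λ K) {x x' z : V} (hx : x ∈ inducedLattice Λ K)
    (hx' : x' ∈ inducedLattice Λ K) (hz : z - x ∈ region Λ T K) (hz' : z - x' ∈ region Λ T K) :
    x = x' := by
  obtain ⟨a, ha, h⟩ := exists_sub_mem_span_of_mem_region hz
  obtain ⟨a', ha', h'⟩ := exists_sub_mem_span_of_mem_region hz'
  have horth : ∀ y ∈ inducedLattice Λ K, y ∈ orth K := fun y hy =>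
    mem_orth_iff.2 (mem_inducedLattice_iff.1 hy).2
  have h0 : (x' + a') - (x + a) = 0 := by
    refine eq_zero_of_mem_span_of_mem_orth (C := K) ?_ ?_
    · have := sub_mem h h'
      convert this using 1
      abel
    · exact sub_mem (add_mem (horth x' hx') (hT.mem_orth hK ha'))
        (add_mem (horth x hx) (hT.mem_orth hK ha))
  refine hT.unique hK hx hx' (z := x + a) (by simpa using ha) ?_
  rw [← sub_eq_zero.1 h0]
  simpa using ha'

/-- Subtract `a ∈ L(C)` so that the component of `z` in `C^⊥` falls into `T(C)`. If `z - a` is not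
in `R(C)`, it can only have been removed by an admissible translate for a proper face, and shifting
back by `a` preserves admissibility. -/
theorem exists_mem_region (hT : IsDomainChoice Λ T) {C : Set V} (hC : IsPointedRationalCone Λ C)
    {z : V} (hz : z ∈ coveringComplex Λ (T {0}) (polar C)) :
    ∃ G, IsFace C G ∧ ∃ x ∈ latticeTranslationSet Λ (region Λ T) G C, z - x ∈ region Λ T G := by
  set S := Submodule.span ℝ C
  have hdec := S.starProjection_add_starProjection_orthogonal z
  obtain ⟨a, ha, haT⟩ := hT.exists_sub_mem hC (z := Sᗮ.starProjection z)
    (Submodule.starProjection_apply_mem _ _)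
  by_cases hreg : z - a ∈ region Λ T C
  · exact ⟨C, hC.isFace_self, a, by rwa [latticeTranslationSet_self], hreg⟩
  by_cases h : C = {0}
  · subst h
    refine absurd ?_ hreg
    rw [region_zero]
    have : S.starProjection z = 0 := by simp [S]
    rw [this, zero_add] at hdec
    rwa [hdec] at haT
  have hcc := sub_mem_coveringComplex_polar hz ha
  have hcol : z - a ∈ T C + (S : Set V) := by
    refine ⟨_, haT, S.starProjection z, Submodule.starProjection_apply_mem _ _, ?_⟩
    change Sᗮ.starProjection z - a + S.starProjection z = z - a
    conv_rhs => rw [← hdec]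
    abel
  rw [region_of_ne h] at hreg
  have hmem : z - a ∈ ⋃ K ∈ {K | IsProperFace C K},
      translationSet Λ (region Λ T) K C + region Λ T K := by
    by_contra hcon
    exact hreg ⟨⟨hcon, hcol⟩, hcc⟩
  obtain ⟨K, hK, x, hx, r, hr, hxr⟩ := Set.mem_iUnion₂.1 hmem
  refine ⟨K, hK.1, x + a, add_mem_latticeTranslationSet hC hK.1
    (by rwa [latticeTranslationSet_of_ne hK.2]) ha, ?_⟩
  have : z - (x + a) = r := by
    have : x + r = z - a := hxr
    rw [← sub_sub, sub_right_comm, ← this, add_sub_cancel_left]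
  rwa [this]

/-- Equal faces are separated by the lattice, comparable ones by the removal in the recursion,
incomparable ones by condition 2. -/
theorem cone_tiling_unique (hT : IsDomainChoice Λ T) {C K K' : Set V}
    (hC : IsPointedRationalCone Λ C) (hK : IsFace C K) (hK' : IsFace C K') {x x' z : V}
    (hx : x ∈ translationSet Λ (region Λ T) K C) (hx' : x' ∈ translationSet Λ (region Λ T) K' C)
    (hz : z - x ∈ region Λ T K) (hz' : z - x' ∈ region Λ T K') : K = K' ∧ x = x' := by
  by_cases heq : K = K'
  · subst heq
    exact ⟨rfl, region_translate_unique hT (hC.face hK) (translationSet_subset_inducedLattice hx)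
      (translationSet_subset_inducedLattice hx') hz hz'⟩
  exfalso
  by_cases h1 : K ⊆ K'
  · exact not_mem_of_isProperFace hC hK' ⟨hC.face_mono hK' hK h1, heq⟩ hx
      (translationSet_subset_inducedLattice hx') hz hz'
  by_cases h2 : K' ⊆ K
  · exact not_mem_of_isProperFace hC hK ⟨hC.face_mono hK hK' h2, Ne.symm heq⟩ hx'
      (translationSet_subset_inducedLattice hx) hz' hz
  have hKC : K ≠ C := by
    rintro rfl
    exact h2 hK'.subset
  have hKC' : K' ≠ C := by
    rintro rfl
    exact h1 hK.subset
  exact Set.disjoint_left.1 (((mem_translationSet_iff hKC).1 hx).2.2 K' ⟨hK', hKC'⟩ h1 h2 x'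
    (translationSet_subset_inducedLattice hx')) (mem_vadd_iff.2 hz) (mem_vadd_iff.2 hz')

/-- A cell that meets an admissible translate of `region K` lies strictly inside all the facets
of `polar C` that do not come from rays of `K`. -/
theorem cell_inner_neg (hT : IsDomainChoice Λ T) {C K M : Set V}
    (hC : IsPointedRationalCone Λ C) (hK : IsProperFace C K) {x y z z' m : V}
    (hx : x ∈ translationSet Λ (region Λ T) K C) (hz : z - x ∈ region Λ T K) (hy : y ∈ Λ)
    (hzy : z - y ∈ T {0}) (hM : IsRay C M) (hMK : ¬ M ⊆ K) (hm : m ∈ M) (hm0 : m ≠ 0)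
    (hzy' : z' - y ∈ T {0}) : ⟪z', m⟫ < 0 := by
  by_contra! hcon
  have h0 := hC.face hC.isFace_zero
  have hzm := inner_neg_of_mem_translationSet hC hK.2 hx hz hM hMK hm hm0
  -- By connectedness, a cell with points on both sides of the wall of `m` has a point on it. Hence
  -- it meets `M^∨`, and the covering for the one-dimensional cone `M` applies to `z`.
  obtain ⟨a, ha, ham⟩ : ∃ a ∈ T {0}, ⟪y + a, m⟫ = 0 := by
    have hpre := (hT _ h0).connected.isPreconnected
    have hc : ContinuousOn (fun a : V => ⟪y + a, m⟫) (T {0}) := by fun_prop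
    have h0 : (0 : ℝ) ∈ Set.Icc ⟪y + (z - y), m⟫ ⟪y + (z' - y), m⟫ :=
      ⟨by simpa using hzm.le, by simpa using hcon⟩
    exact hpre.intermediate_value hzy hzy' hc h0
  have hpol : y + a ∈ polar M := by
    obtain ⟨m', -, hMm⟩ := hC.exists_generator hM
    rw [hMm] at hm
    obtain ⟨b, hb, rfl⟩ := hm
    have hb0 : b ≠ 0 := by
      rintro rfl
      simp at hm0
    rw [real_inner_smul_right] at ham
    have ham' := (mul_eq_zero.1 ham).resolve_left hb0
    intro v hv
    rw [hMm] at hv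
    obtain ⟨c, -, rfl⟩ := hv
    rw [real_inner_smul_right, ham', mul_zero]
  have hcc : z ∈ coveringComplex Λ (T {0}) (polar M) :=
    mem_coveringComplex_iff.2 ⟨y, hy, hzy, y + a, hpol, by simpa using ha⟩
  have hMr := hC.face hM.1
  obtain ⟨G, hG, x₁, hx₁, hzx₁⟩ := exists_mem_region hT hMr hcc
  -- If `z` lies in a translate of `R(M)`, this contradicts `x ∈ X_K^C`. Otherwise the whole cell is
  -- an admissible translate of `T` for `M`, hence strictly inside the wall, against the point `y +
  -- a`.
  by_cases hGM : G = M
  · subst hGM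
    rw [latticeTranslationSet_self] at hx₁
    by_cases hKM : K ⊆ G
    · refine not_mem_of_isProperFace hC hM.1 ⟨hC.face_mono hM.1 hK.1 hKM, ?_⟩ hx hx₁ hz hzx₁
      rintro rfl
      exact hMK subset_rfl
    · have hMC : G ≠ C := by
        rintro rfl
        exact hKM hK.1.subset
      exact Set.disjoint_left.1 (((mem_translationSet_iff hK.2).1 hx).2.2 G ⟨hM.1, hMC⟩ hKM hMK x₁
        hx₁) (mem_vadd_iff.2 hz) (mem_vadd_iff.2 hzx₁)
  · have hG0 := hC.eq_zero_of_isProperFace_ray hM ⟨hG, hGM⟩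
    subst hG0
    rw [latticeTranslationSet_of_ne hGM] at hx₁
    rw [region_zero] at hzx₁
    have hx₁y : x₁ = y := hT.unique h0 (translationSet_subset_inducedLattice hx₁)
      (mem_inducedLattice_zero.2 hy) hzx₁ hzy
    subst hx₁y
    have := inner_neg_of_mem_translationSet hMr hGM hx₁ (z := x₁ + a)
      (by rw [region_zero]; simpa using ha) ⟨hMr.isFace_self, hM.2⟩
      (fun hsub => hm0 (hsub hm)) hm hm0
    exact this.ne ham

/-- The cell of `z - x` meets `K^∨` at some `q`, and `q + x` lies in `C^∨`: rays in `K` are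
orthogonal to `x`, and for the other rays the whole cell is on the right side by `cell_inner_neg`.
-/
theorem translate_region_subset (hT : IsDomainChoice Λ T) {C K : Set V}
    (hC : IsPointedRationalCone Λ C) (hK : IsFace C K) {x z : V}
    (hx : x ∈ translationSet Λ (region Λ T) K C) (hz : z - x ∈ region Λ T K) :
    z ∈ coveringComplex Λ (T {0}) (polar C) := by
  by_cases hKC : K = C
  · subst hKC
    rw [translationSet_self, Set.mem_singleton_iff] at hx
    rw [hx, sub_zero] at hz
    exact region_subset_coveringComplex hz
  have hxL := mem_inducedLattice_iff.1 (translationSet_subset_inducedLattice hx)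
  obtain ⟨y, hy, hzy, q, hq, hqy⟩ :=
    mem_coveringComplex_iff.1 (region_subset_coveringComplex hz)
  have hzy' : z - (x + y) ∈ T {0} := by rwa [← sub_sub]
  have hqy' : q + x - (x + y) ∈ T {0} := by rwa [add_comm q, add_sub_add_left_eq_sub]
  refine mem_coveringComplex_iff.2 ⟨x + y, add_mem hxL.1 hy, hzy', q + x,
    hC.mem_polar_of_rays fun M hM m hm => ?_, hqy'⟩
  by_cases hMK : M ⊆ K
  · rw [inner_add_left, hxL.2 m (hMK hm), add_zero]
    exact hq m (hMK hm)
  · by_cases hm0 : m = 0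
    · rw [hm0, inner_zero_right]
    · exact (cell_inner_neg hT hC ⟨hK, hKC⟩ hx hz (add_mem hxL.1 hy) hzy' hM hMK hm hm0 hqy').le

/-- By induction, a point `z` of `R(C)` must be near the wall of a ray outside each proper face. The
sum of such rays, one for each inequality not identically tight, is relatively interior to `C`. As
`z` is near `C^∨`, this bounds its component in the span of `C`; the other component is in `T(C)`.
-/
theorem isBounded_region (hT : IsDomainChoice Λ T) {C : Set V} (hC : IsPointedRationalCone Λ C) :
    Bornology.IsBounded (region Λ T C) := by
  classical
  induction hn : Module.finrank ℝ (vectorSpan ℝ C) using Nat.strong_induction_on generalizing C with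
  | _ n ih =>
  subst hn
  have h0 := hC.face hC.isFace_zero
  have hfin : {K | IsProperFace C K}.Finite := hC.finite_faces.subset fun K hK => hK.1
  obtain ⟨ρ, hρ⟩ := ((Bornology.isBounded_biUnion hfin).2 fun K hK =>
    ih _ (IsProperFace.finrank_lt hK) (hC.face hK.1) rfl).exists_norm_le
  replace hρ : ∀ F, IsProperFace C F → ∀ a ∈ region Λ T F, ‖a‖ ≤ ρ := fun F hF a ha =>
    hρ a (Set.mem_biUnion (x := F) hF ha)
  obtain ⟨δ, hδ⟩ := (hT _ h0).bounded.exists_norm_le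
  obtain ⟨τ, hτ⟩ := (hT _ hC).bounded.exists_norm_le
  have hgen : ∀ M, ∃ g : V, IsRay C M → ‖g‖ = 1 ∧ M = {x | ∃ a : ℝ, 0 ≤ a ∧ x = a • g} := by
    intro M
    by_cases hM : IsRay C M
    · obtain ⟨m, hm⟩ := hC.exists_generator hM
      exact ⟨m, fun _ => hm⟩
    · exact ⟨0, fun h => absurd h hM⟩
  choose g hg using hgen
  have hgM : ∀ M, IsRay C M → g M ∈ M := fun M hM => by
    rw [(hg M hM).2]
    exact ⟨1, zero_le_one, by rw [one_smul, ← (hg M hM).2]⟩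
  -- Otherwise the translate covering `z` in `DC(K^∨)` would be admissible for `C` by
  -- `mem_translationSet_of_far`, and so removed from `R(C)`.
  have hnear : ∀ z ∈ region Λ T C, ∀ K, IsProperFace C K →
      ∃ M, IsRay C M ∧ ¬ M ⊆ K ∧ -(3 * ρ) ≤ ⟪z, g M⟫ := by
    intro z hz K hK
    by_contra! hcon
    have hcc := coveringComplex_mono (polar_anti hK.1.subset)
      (region_subset_coveringComplex hz)
    obtain ⟨G, hG, x, hx, hzx⟩ := exists_mem_region hT (hC.face hK.1) hcc
    have hGC : G ≠ C := by
      rintro rfl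
      exact hK.2 (Set.Subset.antisymm hK.1.subset hG.subset)
    refine not_mem_region_of_mem_translate ⟨hC.face_trans hK.1 hG, hGC⟩ hz
      (mem_translationSet_of_far hC hK.1 hG hGC hρ hx hzx fun M hM hMK m hm hm0 => ?_) hzx
    have h1 := hcon M hM hMK
    rw [(hg M hM).2] at hm
    obtain ⟨a, ha, rfl⟩ := hm
    have ha' : 0 < a := lt_of_le_of_ne ha (by rintro rfl; simp at hm0)
    rw [real_inner_smul_right, norm_smul, (hg M hM).1, Real.norm_of_nonneg ha]
    have := mul_lt_mul_of_pos_left h1 ha'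
    linarith
  have hCr := hC
  obtain ⟨W, hW, rfl⟩ := hC.exists_eq
  have hrays : {M | IsRay (halfspaceCone W) M}.Finite := hCr.finite_faces.subset fun M hM => hM.1
  obtain ⟨ε, hε, hεW⟩ : ∃ ε : ℝ, 0 < ε ∧ ∀ M ∈ {M | IsRay (halfspaceCone W) M}, ∀ w ∈ W,
      ⟪g M, w⟫ < 0 → ⟪g M, w⟫ + ε * ‖w‖ ≤ 0 := by
    have : ∀ᶠ ε : ℝ in 𝓝[>] 0, ∀ M ∈ {M | IsRay (halfspaceCone W) M}, ∀ w ∈ W,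
        ⟪g M, w⟫ < 0 → ⟪g M, w⟫ + ε * ‖w‖ ≤ 0 := by
      rw [Filter.eventually_all_finite hrays]
      intro M hM
      rw [Filter.eventually_all_finset]
      intro w hw
      by_cases h : ⟪g M, w⟫ < 0
      · have hc : Continuous fun ε : ℝ => ⟪g M, w⟫ + ε * ‖w‖ := by fun_prop
        have : ∀ᶠ ε : ℝ in 𝓝 0, ⟪g M, w⟫ + ε * ‖w‖ < 0 := by
          apply hc.continuousAt.eventually_lt_const
          simpa using h
        exact (this.filter_mono nhdsWithin_le_nhds).mono fun _ h _ => h.le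
      · exact Filter.Eventually.of_forall fun _ h' => absurd h' h
    obtain ⟨ε, h1, h2⟩ := (this.and self_mem_nhdsWithin).exists
    exact ⟨ε, h2, h1⟩
  set A := W.filter fun w => ¬ ∀ x ∈ halfspaceCone W, ⟪x, w⟫ = 0
  refine isBounded_iff_forall_norm_le.2
    ⟨τ + (2 * δ + A.card * (3 * ρ + 2 * δ) / ε), fun z hz => ?_⟩
  have hpick : ∀ w, ∃ v ∈ halfspaceCone W, w ∈ A →
      ‖v‖ = 1 ∧ -(3 * ρ) ≤ ⟪z, v⟫ ∧ ⟪v, w⟫ + ε * ‖w‖ ≤ 0 := by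
    intro w
    by_cases hw : w ∈ A
    · obtain ⟨hwW, hw0⟩ := Finset.mem_filter.1 hw
      push Not at hw0
      obtain ⟨x, hx, hxw⟩ := hw0
      obtain ⟨M, hM, hMK, hMz⟩ := hnear z hz _
        ⟨hCr.isFace_iff.2 (isExtremeCone_functional (W := W) (a := w) fun x hx => hx w hwW),
          fun heq => hxw (heq.symm ▸ hx : x ∈ {x | x ∈ halfspaceCone W ∧ ⟪x, w⟫ = 0}).2⟩
      refine ⟨g M, hM.1.subset (hgM M hM), fun _ => ⟨(hg M hM).1, hMz, hεW M hM w hwW ?_⟩⟩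
      refine lt_of_le_of_ne (hM.1.subset (hgM M hM) w hwW) fun hgw => hMK fun m hm => ?_
      refine ⟨hM.1.subset hm, ?_⟩
      rw [(hg M hM).2] at hm
      obtain ⟨a, -, rfl⟩ := hm
      rw [real_inner_smul_left, hgw, mul_zero]
    · exact ⟨0, zero_mem_halfspaceCone W, fun h => absurd h hw⟩
  choose v hv hvA using hpick
  obtain ⟨a, ha, hca⟩ := exists_sub_mem_span_of_mem_region hz
  obtain ⟨y, hy, hzy, u, hu, huy⟩ :=
    mem_coveringComplex_iff.1 (region_subset_coveringComplex hz)
  set c := z - a with hc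
  have hδ0 : 0 ≤ δ := (norm_nonneg _).trans (hδ _ hzy)
  have hzu : ‖z - u‖ ≤ 2 * δ := by
    have := norm_sub_le (z - y) (u - y)
    rw [sub_sub_sub_cancel_right] at this
    linarith [hδ _ hzy, hδ _ huy]
  have hball : ∀ s ∈ Submodule.span ℝ (halfspaceCone W), ‖s‖ ≤ ε →
      ∑ w ∈ A, v w + s ∈ halfspaceCone W := by
    intro s hs hsε w hw
    rw [inner_add_left]
    have hqC := (isExtremeCone_refl W).sum_mem A v (fun w _ => hv w)
    by_cases hwA : w ∈ A
    · have h1 : ⟪∑ w ∈ A, v w, w⟫ ≤ ⟪v w, w⟫ := by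
        rw [← Finset.add_sum_erase A v hwA, inner_add_left, sum_inner]
        have := Finset.sum_nonpos fun w' (_ : w' ∈ A.erase w) => hv w' w hw
        linarith
      have h2 := (real_inner_le_norm s w).trans (mul_le_mul_of_nonneg_right hsε (norm_nonneg w))
      linarith [(hvA w hwA).2.2]
    · have hw0 : ∀ x ∈ halfspaceCone W, ⟪x, w⟫ = 0 := by
        by_contra hcon
        exact hwA (Finset.mem_filter.2 ⟨hw, hcon⟩)
      have : ⟪s, w⟫ = 0 := by
        rw [real_inner_comm]
        refine (Submodule.mem_orthogonal' _ _).1 (mem_orth_iff.2 fun x hx => ?_) s hs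
        rw [real_inner_comm]
        exact hw0 x hx
      rw [this, add_zero]
      exact hqC w hw
  have hcb : ‖c‖ ≤ 2 * δ + A.card * (3 * ρ + 2 * δ) / ε := by
    have huv : ∀ w ∈ A, -(3 * ρ + 2 * δ) ≤ ⟪u, v w⟫ := by
      intro w hw
      have h1 := (real_inner_le_norm (z - u) (v w))
      rw [(hvA w hw).1, mul_one, inner_sub_left] at h1
      linarith [(hvA w hw).2.1]
    have hsum : -(A.card * (3 * ρ + 2 * δ)) ≤ ⟪u, ∑ w ∈ A, v w⟫ := by
      rw [inner_sum]
      have := Finset.card_nsmul_le_sum A _ _ huv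
      rw [nsmul_eq_mul] at this
      linarith
    by_cases hc0 : c = 0
    · have := hu _ (hball 0 (zero_mem _) (by simpa using hε.le))
      rw [add_zero] at this
      have : 0 ≤ A.card * (3 * ρ + 2 * δ) := by linarith
      rw [hc0, norm_zero]
      positivity
    · have hcn : 0 < ‖c‖ := norm_pos_iff.2 hc0
      have hsn : ‖(ε / ‖c‖) • c‖ = ε := by
        rw [norm_smul, Real.norm_of_nonneg (by positivity), div_mul_cancel₀ _ hcn.ne']
      -- Test `u ∈ C^∨` against the relatively interior point pushed by `ε` in direction `c`. The
      -- push contributes about `ε * ‖c‖`, while the inner product with the sum is bounded below.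
      have h1 := hu _ (hball ((ε / ‖c‖) • c) (Submodule.smul_mem _ _ hca) hsn.le)
      rw [inner_add_right] at h1
      have h2 := (real_inner_le_norm (z - u) ((ε / ‖c‖) • c)).trans
        (mul_le_mul_of_nonneg_right hzu (norm_nonneg _))
      rw [hsn, inner_sub_left] at h2
      have h3 : ⟪z, (ε / ‖c‖) • c⟫ = ε * ‖c‖ := by
        have : z = c + a := by rw [hc, sub_add_cancel]
        rw [this, inner_add_left, real_inner_smul_right, real_inner_smul_right,
          real_inner_self_eq_norm_sq, (Submodule.mem_orthogonal' _ _).1 (hT.mem_orth hCr ha) c hca,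
          mul_zero, add_zero]
        field_simp
      have h4 : ε * ‖c‖ ≤ 2 * δ * ε + A.card * (3 * ρ + 2 * δ) := by linarith
      rw [show 2 * δ + A.card * (3 * ρ + 2 * δ) / ε =
        (2 * δ * ε + A.card * (3 * ρ + 2 * δ)) / ε by field_simp, le_div_iff₀ hε]
      linarith
  have : z = a + c := by rw [hc]; abel
  rw [this]
  exact (norm_add_le _ _).trans (add_le_add (hτ a ha) hcb)

end Regions

/-! ### Polytopes, normal cones and large dilates -/

section Polytopes

variable {V : Type*} [NormedAddCommGroup V] [InnerProductSpace ℝ V]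

theorem isCompact_convexHull_finset (S : Finset V) : IsCompact (convexHull ℝ (S : Set V)) :=
  S.finite_toSet.isCompact_convexHull ℝ

theorem IsFace.isCompact {P f : Set V} (hP : IsCompact P) (h : IsFace P f) : IsCompact f :=
  h.1.isCompact hP

theorem isFace_argmax {P : Set V} {p v : V} (hv : v ∈ P) (h : ∀ y ∈ P, ⟪p, y - v⟫ ≤ 0) :
    IsFace P {y | y ∈ P ∧ ⟪p, y - v⟫ = 0} := by
  refine ⟨fun _ => ⟨innerSL ℝ p, Set.ext fun x => ?_⟩, v, hv, by simp⟩
  simp only [Set.mem_ofPred_eq, innerSL_apply_apply]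
  refine and_congr_right fun hx => ⟨fun h0 y hy => ?_, fun h0 => le_antisymm (h x hx) ?_⟩
  · have := h y hy
    rw [inner_sub_right] at *
    linarith
  · have := h0 v hv
    rw [inner_sub_right]
    linarith

theorem mem_normalCone_singleton {P : Set V} {v n : V} :
    n ∈ normalCone P {v} ↔ ∀ y ∈ P, ⟪n, y - v⟫ ≤ 0 := by
  simp [normalCone]

theorem normalCone_anti {P f g : Set V} (h : f ⊆ g) : normalCone P g ⊆ normalCone P f :=
  fun _ hn s hs => hn s (h hs)

theorem mem_normalCone_of_singleton {P : Set V} {v u n : V} (hn : n ∈ normalCone P {v})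
    (h : ⟪n, u - v⟫ = 0) : n ∈ normalCone P {u} := by
  rw [mem_normalCone_singleton] at *
  intro y hy
  have := hn y hy
  rw [inner_sub_right] at *
  linarith

/-- The upper half space bounds needed only be checked at the generating points. -/
theorem inner_sub_nonpos_of_forall_finset {S : Finset V} {n v : V}
    (h : ∀ y ∈ S, ⟪n, y - v⟫ ≤ 0) : ∀ y ∈ convexHull ℝ (S : Set V), ⟪n, y - v⟫ ≤ 0 := by
  have hconv : Convex ℝ {y : V | ⟪n, y⟫ ≤ ⟪n, v⟫} :=
    convex_halfSpace_le (innerₛₗ ℝ n).isLinear _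
  intro y hy
  have := convexHull_min (t := {y : V | ⟪n, y⟫ ≤ ⟪n, v⟫}) (fun y hy => by
    have := h y hy
    rw [inner_sub_right] at this
    rw [Set.mem_ofPred_eq]
    linarith) hconv hy
  rw [inner_sub_right]
  rw [Set.mem_ofPred_eq] at this
  linarith

theorem IsFace.extremePoints_subset {P f : Set V} (h : IsFace P f) :
    f.extremePoints ℝ ⊆ P.extremePoints ℝ :=
  h.1.isExtreme.extremePoints_subset_extremePoints

theorem IsFace.extremePoints_subset_finset {S : Finset V} {f : Set V}
    (h : IsFace (convexHull ℝ (S : Set V)) f) : f.extremePoints ℝ ⊆ S :=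
  h.extremePoints_subset.trans extremePoints_convexHull_subset

theorem IsFace.mem_extremePoints {P f : Set V} (h : IsFace P f) {v : V}
    (hv : v ∈ P.extremePoints ℝ) (hvf : v ∈ f) : v ∈ f.extremePoints ℝ :=
  inter_extremePoints_subset_extremePoints_of_subset h.subset ⟨hvf, hv⟩

theorem IsFace.extremePoints_nonempty {P f : Set V} (hP : IsCompact P) (h : IsFace P f) :
    (f.extremePoints ℝ).Nonempty := (h.isCompact hP).extremePoints_nonempty h.2

theorem IsFace.subset_of_finset {S : Finset V} {f A : Set V}
    (h : IsFace (convexHull ℝ (S : Set V)) f) (hA : IsClosed A) (hAc : Convex ℝ A)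
    (hS : ∀ s ∈ S, s ∈ f → s ∈ A) : f ⊆ A := by
  have hc := h.isCompact (isCompact_convexHull_finset S)
  rw [← closure_convexHull_extremePoints hc (h.1.convex (convex_convexHull ℝ _))]
  refine closure_minimal (convexHull_min (fun s hs => ?_) hAc) hA
  exact hS s (h.extremePoints_subset_finset hs) hs.1

theorem finite_faces_polytope (S : Finset V) :
    {f | IsFace (convexHull ℝ (S : Set V)) f}.Finite := by
  classical
  have hrec : ∀ f, IsFace (convexHull ℝ (S : Set V)) f →
      f = closure (convexHull ℝ ((S : Set V) ∩ f)) := by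
    intro f hf
    have hc := hf.isCompact (isCompact_convexHull_finset S)
    have hcv := hf.1.convex (convex_convexHull ℝ _)
    apply Set.Subset.antisymm
    · exact hf.subset_of_finset isClosed_closure (convex_convexHull ℝ _).closure
        fun s hs hsf => subset_closure (subset_convexHull ℝ _ ⟨hs, hsf⟩)
    · exact closure_minimal (convexHull_min Set.inter_subset_right hcv) hc.isClosed
  refine Set.Finite.of_finite_image (f := fun f => (S : Set V) ∩ f) ?_ ?_
  · refine (S.finite_toSet.finite_subsets).subset ?_
    rintro _ ⟨f, -, rfl⟩
    exact Set.inter_subset_left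
  · intro f hf g hg hfg
    rw [hrec f hf, hrec g hg]
    exact congrArg (fun A => closure (convexHull ℝ A)) hfg

theorem normalCone_eq_halfspaceCone [DecidableEq V] {S A : Finset V} {f : Set V}
    (h : IsFace (convexHull ℝ (S : Set V)) f) (hA : ∀ s, s ∈ A ↔ s ∈ S ∧ s ∈ f) :
    normalCone (convexHull ℝ (S : Set V)) f =
      halfspaceCone ((S ×ˢ A).image fun y => y.1 - y.2) := by
  ext n
  simp only [halfspaceCone, Finset.mem_image, Finset.mem_product, Prod.exists,
    Set.mem_ofPred_eq]
  constructor
  · rintro hn _ ⟨y, s, ⟨hy, hs⟩, rfl⟩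
    exact hn s ((hA s).1 hs).2 y (subset_convexHull ℝ _ hy)
  · intro hn s hs
    have hsub : f ⊆ ⋂ y ∈ S, {s | ⟪n, y⟫ ≤ ⟪n, s⟫} := by
      refine h.subset_of_finset (isClosed_biInter fun y _ =>
        isClosed_le continuous_const (by fun_prop)) (convex_iInter₂ fun y _ =>
          convex_halfSpace_ge (innerₛₗ ℝ n).isLinear _) fun s hs hsf => ?_
      refine Set.mem_iInter₂.2 fun y hy => ?_
      have := hn _ ⟨y, s, ⟨hy, (hA s).2 ⟨hs, hsf⟩⟩, rfl⟩
      rw [inner_sub_right] at this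
      rw [Set.mem_ofPred_eq]
      linarith
    refine inner_sub_nonpos_of_forall_finset fun y hy => ?_
    have := Set.mem_iInter₂.1 (hsub hs) y hy
    rw [Set.mem_ofPred_eq] at this
    rw [inner_sub_right]
    linarith

theorem isPointedRationalCone_normalCone {Λ : Submodule ℤ V} {S : Finset V} (hS : (S : Set V) ⊆ Λ)
    (hdim : affineSpan ℝ (convexHull ℝ (S : Set V)) = ⊤) {f : Set V}
    (h : IsFace (convexHull ℝ (S : Set V)) f) :
    IsPointedRationalCone Λ (normalCone (convexHull ℝ (S : Set V)) f) := by
  classical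
  refine ⟨⟨_, ?_, normalCone_eq_halfspaceCone (A := S.filter (· ∈ f)) h (by simp)⟩,
    fun U hU => ?_⟩
  · intro x hx
    simp only [Finset.coe_image, Set.mem_image, Finset.mem_coe, Finset.mem_product,
      Finset.mem_filter, Prod.exists] at hx
    obtain ⟨y, s, ⟨hy, hs, -⟩, rfl⟩ := hx
    exact sub_mem (hS hy) (hS hs)
  · rw [Submodule.eq_bot_iff]
    intro n hn
    obtain ⟨s, hs⟩ := h.2
    have hz : ∀ y ∈ convexHull ℝ (S : Set V), ⟪n, y - s⟫ = 0 := by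
      intro y hy
      have h1 := hU hn s hs y hy
      have h2 := hU (U.neg_mem hn) s hs y hy
      rw [inner_neg_left] at h2
      linarith
    have hspan : vectorSpan ℝ (convexHull ℝ (S : Set V)) = ⊤ := by
      rw [← direction_affineSpan, hdim, AffineSubspace.direction_top]
    have hle : vectorSpan ℝ (convexHull ℝ (S : Set V)) ≤ (Submodule.span ℝ {n})ᗮ := by
      rw [vectorSpan_eq_span_vsub_set_right ℝ (h.subset hs), Submodule.span_le]
      rintro _ ⟨y, hy, rfl⟩
      exact Submodule.mem_orthogonal_singleton_iff_inner_right.2 (hz y hy)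
    rw [hspan] at hle
    exact inner_self_eq_zero.1
      (Submodule.mem_orthogonal_singleton_iff_inner_right.1 (hle (Submodule.mem_top (x := n))))

theorem isFace_normalCone {Λ : Submodule ℤ V} {P f : Set V} {v : V} (hfP : f ⊆ P) (hv : v ∈ f)
    (hr : IsPointedRationalCone Λ (normalCone P {v})) :
    IsFace (normalCone P {v}) (normalCone P f) := by
  rw [hr.isFace_iff]
  refine ⟨normalCone_anti (by simpa using hv), ?_, ?_, ?_, ?_⟩
  · intro s _ y _
    simp
  · intro n hn n' hn' s hs y hy
    rw [inner_add_left]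
    exact add_nonpos (hn s hs y hy) (hn' s hs y hy)
  · intro n hn a ha s hs y hy
    rw [real_inner_smul_left]
    exact mul_nonpos_of_nonneg_of_nonpos ha (hn s hs y hy)
  · intro x hx y hy hxy s hs y' hy'
    rw [mem_normalCone_singleton] at hx hy
    have h1 := hx s (hfP hs)
    have h2 := hy s (hfP hs)
    have h3 := hxy s hs v (hfP hv)
    have h4 := hx y' hy'
    rw [inner_add_left] at h3
    simp only [inner_sub_right] at *
    linarith

theorem isFace_inter_normalCone {Λ : Submodule ℤ V} {P : Set V} {u v : V} (hu : u ∈ P)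
    (hv : v ∈ P) (hr : IsPointedRationalCone Λ (normalCone P {u})) :
    IsFace (normalCone P {u}) (normalCone P {u} ∩ normalCone P {v}) := by
  have h : ∀ n ∈ normalCone P {u}, ⟪n, v - u⟫ ≤ 0 :=
    fun n hn => mem_normalCone_singleton.1 hn v hv
  have heq : normalCone P {u} ∩ normalCone P {v} =
      {n | n ∈ normalCone P {u} ∧ ⟪n, v - u⟫ = 0} := by
    ext n
    refine and_congr_right fun hn => ⟨fun hn' => ?_, mem_normalCone_of_singleton hn⟩
    have h1 := h n hn
    have h2 := mem_normalCone_singleton.1 hn' u hu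
    rw [inner_sub_right] at *
    linarith
  rw [heq, hr.isFace_iff]
  obtain ⟨W, -, hW⟩ := hr.exists_eq
  rw [hW] at h ⊢
  exact isExtremeCone_functional h

theorem exists_extremePoint_max {P : Set V} (hP : IsCompact P) (hne : P.Nonempty) (n : V) :
    ∃ v ∈ P.extremePoints ℝ, ∀ y ∈ P, ⟪n, y - v⟫ ≤ 0 := by
  obtain ⟨y₀, hy₀, hmax⟩ := hP.exists_isMaxOn hne (f := fun y => ⟪n, y⟫)
    (by fun_prop)
  have h0 : ∀ y ∈ P, ⟪n, y - y₀⟫ ≤ 0 := fun y hy => by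
    have : ⟪n, y⟫ ≤ ⟪n, y₀⟫ := hmax hy
    rw [inner_sub_right]
    linarith
  have hface := isFace_argmax hy₀ h0
  obtain ⟨v, hv⟩ := hface.extremePoints_nonempty hP
  refine ⟨v, hface.extremePoints_subset hv, fun y hy => ?_⟩
  have h1 := h0 y hy
  have h2 := hv.1.2
  rw [inner_sub_right] at *
  linarith

theorem halfspaceCone_eq_normalCone_singleton [DecidableEq V] {S : Finset V} {v : V} :
    halfspaceCone (S.image fun y => y - v) = normalCone (convexHull ℝ (S : Set V)) {v} := by
  ext n
  rw [mem_normalCone_singleton]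
  simp only [halfspaceCone, Finset.mem_image, Set.mem_ofPred_eq, forall_exists_index, and_imp,
    forall_apply_eq_imp_iff₂]
  exact ⟨inner_sub_nonpos_of_forall_finset, fun h y hy => h y (subset_convexHull ℝ _ hy)⟩

theorem exists_add_smul_mem_normalCone {S : Finset V} {v q x : V}
    (h : ∀ y ∈ S, ⟪q, y - v⟫ < 0 ∨ (⟪q, y - v⟫ ≤ 0 ∧ ⟪x, y - v⟫ ≤ 0)) :
    ∃ ε : ℝ, 0 < ε ∧ q + ε • x ∈ normalCone (convexHull ℝ (S : Set V)) {v} := by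
  classical
  obtain ⟨ε, hε, hmem⟩ := exists_small_add (W := S.image fun y => y - v) (q := q) (x := x) (by
    simpa using h)
  exact ⟨ε, hε, by rw [← halfspaceCone_eq_normalCone_singleton]; exact hmem⟩

/-- Every face of the normal cone at a vertex is the normal cone of a face. -/
theorem exists_face_normalCone_eq {S : Finset V} {v : V} {G : Set V}
    (hv : v ∈ convexHull ℝ (S : Set V))
    (hG : IsFace (normalCone (convexHull ℝ (S : Set V)) {v}) G) :
    ∃ f, IsFace (convexHull ℝ (S : Set V)) f ∧ v ∈ f ∧
      normalCone (convexHull ℝ (S : Set V)) f = G := by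
  classical
  set P := convexHull ℝ (S : Set V)
  have hG' := hG
  rw [← halfspaceCone_eq_normalCone_singleton, isFace_iff] at hG'
  -- The required face is the set of maximizers over `P` of a relative interior point `q` of `G`.
  obtain ⟨q, hq, hqw⟩ := exists_relint hG'
  rw [halfspaceCone_eq_normalCone_singleton] at hG'
  have hqP := mem_normalCone_singleton.1 (hG'.subset hq)
  have hface := isFace_argmax hv hqP
  refine ⟨_, hface, ⟨hv, by simp⟩, Set.Subset.antisymm (fun n hn => ?_) fun g hg => ?_⟩
  · have hnv : ∀ y ∈ P, ⟪n, y - v⟫ ≤ 0 := hn v ⟨hv, by simp⟩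
    obtain ⟨ε, hε, hmem⟩ := exists_add_smul_mem_normalCone (S := S) (v := v) (q := q) (x := -n)
      (fun y hy => by
        have hyP : y ∈ P := subset_convexHull ℝ _ hy
        rcases (hqP y hyP).lt_or_eq with h1 | h1
        · exact Or.inl h1
        · refine Or.inr ⟨h1.le, ?_⟩
          have := hn y ⟨hyP, h1⟩ v hv
          rw [inner_neg_left]
          rw [inner_sub_right] at *
          linarith)
    have hCC : IsExtremeCone (normalCone P {v}) (normalCone P {v}) := by
      rw [← halfspaceCone_eq_normalCone_singleton]
      exact isExtremeCone_refl _
    have h1 : ε • n ∈ G := by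
      refine hG'.left_mem _ (hCC.smul_mem n (mem_normalCone_singleton.2 hnv) ε hε.le) _ hmem ?_
      simpa using hq
    have := hG'.smul_mem _ h1 ε⁻¹ (inv_nonneg.2 hε.le)
    rwa [smul_smul, inv_mul_cancel₀ hε.ne', one_smul] at this
  · have hgv := mem_normalCone_singleton.1 (hG'.subset hg)
    obtain ⟨ε, hε, hmem⟩ := exists_add_smul_mem_normalCone (S := S) (v := v) (q := q) (x := -g)
      (fun y hy => by
        rcases hqw (y - v) (Finset.mem_image_of_mem _ hy) with h1 | h1
        · exact Or.inr ⟨(h1 q hq).le, by rw [inner_neg_left, h1 g hg, neg_zero]⟩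
        · exact Or.inl h1)
    intro s hs y hy
    have h1 := mem_normalCone_singleton.1 hmem s hs.1
    rw [inner_add_left, hs.2, zero_add, real_inner_smul_left, inner_neg_left] at h1
    have h2 : 0 ≤ ⟪g, s - v⟫ := by
      by_contra! hcon
      have := mul_pos hε (neg_pos.2 hcon)
      linarith
    have h3 := hgv y hy
    rw [inner_sub_right] at *
    linarith

/-- The sum of the nonpositive functionals is maximal at a vertex. If the maximum is zero, every
summand vanishes there; otherwise it is the gap, which dilation by `t` scales beyond any constant.
-/
theorem exists_common_vertex_or_gap {P : Set V} (hP : IsCompact P) (hne : P.Nonempty)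
    (A : Finset (V × V)) (hA : ∀ i ∈ A, ∀ y ∈ P, ⟪i.2, y - i.1⟫ ≤ 0) :
    (∃ v ∈ P.extremePoints ℝ, ∀ i ∈ A, ⟪i.2, v - i.1⟫ = 0) ∨
      ∃ δ : ℝ, 0 < δ ∧ ∀ y ∈ P, ∑ i ∈ A, ⟪i.2, y - i.1⟫ ≤ -δ := by
  obtain ⟨v, hv, hmax⟩ := exists_extremePoint_max hP hne (∑ i ∈ A, i.2)
  have hsum : ∀ y ∈ P, ∑ i ∈ A, ⟪i.2, y - i.1⟫ ≤ ∑ i ∈ A, ⟪i.2, v - i.1⟫ := by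
    intro y hy
    have := hmax y hy
    rw [sum_inner] at this
    rw [← sub_nonpos, ← Finset.sum_sub_distrib]
    refine le_of_eq_of_le (Finset.sum_congr rfl fun i _ => ?_) this
    rw [← inner_sub_right, sub_sub_sub_cancel_right]
  have hle := Finset.sum_nonpos fun i hi => hA i hi v hv.1
  rcases hle.lt_or_eq with h | h
  · exact Or.inr ⟨_, neg_pos.2 h, fun y hy => by rw [neg_neg]; exact hsum y hy⟩
  · exact Or.inl ⟨v, hv, (Finset.sum_eq_zero_iff_of_nonpos fun i hi => hA i hi v hv.1).1 h⟩

/-- In large dilates, points near to several supporting hyperplanes are only found where these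
have a common vertex. -/
theorem eventually_exists_common_vertex {P : Set V} (hP : IsCompact P) (hne : P.Nonempty)
    (A : Finset (V × V)) (hA : ∀ i ∈ A, ∀ y ∈ P, ⟪i.2, y - i.1⟫ ≤ 0) (κ B : ℝ) :
    ∀ᶠ t : ℕ in atTop, ∀ z : V, (∃ p ∈ P, ‖z - (t : ℝ) • p‖ ≤ κ) →
      (∀ i ∈ A, -B ≤ ⟪i.2, z - (t : ℝ) • i.1⟫) →
      ∃ v ∈ P.extremePoints ℝ, ∀ i ∈ A, ⟪i.2, v - i.1⟫ = 0 := by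
  rcases exists_common_vertex_or_gap hP hne A hA with h | ⟨δ, hδ, hgap⟩
  · exact Filter.Eventually.of_forall fun t z _ _ => h
  have hlarge : ∀ᶠ t : ℕ in atTop, (∑ i ∈ A, (‖i.2‖ * κ + B)) / δ < t :=
    tendsto_natCast_atTop_atTop.eventually_gt_atTop _
  filter_upwards [hlarge] with t ht
  rintro z ⟨p, hp, hzp⟩ hnear
  exfalso
  rw [div_lt_iff₀ hδ] at ht
  have h1 : ∀ i ∈ A, 0 ≤ (‖i.2‖ * κ + B) + t * ⟪i.2, p - i.1⟫ := by
    intro i hi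
    have h2 := hnear i hi
    have h3 := (real_inner_le_norm i.2 (z - (t : ℝ) • p)).trans
      (mul_le_mul_of_nonneg_left hzp (norm_nonneg _))
    have h4 : z - (t : ℝ) • i.1 = (z - (t : ℝ) • p) + (t : ℝ) • (p - i.1) := by
      rw [smul_sub]; abel
    rw [h4, inner_add_right, real_inner_smul_right] at h2
    linarith
  have h2 := Finset.sum_nonneg h1
  rw [Finset.sum_add_distrib, ← Finset.mul_sum] at h2
  have h3 := mul_le_mul_of_nonneg_left (hgap p hp) (Nat.cast_nonneg (α := ℝ) t)
  linarith

variable [FiniteDimensional ℝ V]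

theorem IsFace.exists_exposing {P f : Set V} (h : IsFace P f) :
    ∃ p ∈ normalCone P f, ∀ v ∈ f, ∀ y ∈ P, 0 ≤ ⟪p, y - v⟫ → y ∈ f := by
  obtain ⟨l, hl⟩ := h.1 h.2
  have hp : ∀ x, ⟪(InnerProductSpace.toDual ℝ V).symm l, x⟫ = l x :=
    fun x => InnerProductSpace.toDual_symm_apply
  refine ⟨(InnerProductSpace.toDual ℝ V).symm l, fun s hs y hy => ?_, fun v hv y hy h0 => ?_⟩
  · rw [hl] at hs
    have := hs.2 y hy
    rw [hp, map_sub]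
    linarith
  · rw [hl] at hv ⊢
    rw [hp, map_sub] at h0
    exact ⟨hy, fun y' hy' => (hv.2 y' hy').trans (by linarith)⟩

theorem IsFace.eq_of_normalCone_eq {P f g : Set V} (hf : IsFace P f) (hg : IsFace P g)
    (h : normalCone P f = normalCone P g) : f = g := by
  have key : ∀ f g, IsFace P f → IsFace P g → normalCone P f = normalCone P g → f ⊆ g := by
    intro f g hf hg h y hy
    obtain ⟨p, hp, hpe⟩ := hg.exists_exposing
    obtain ⟨v, hv⟩ := hg.2
    rw [← h] at hp
    refine hpe v hv y (hf.subset hy) ?_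
    have := hp y hy v (hg.subset hv)
    rw [inner_sub_right] at *
    linarith
  exact Set.Subset.antisymm (key f g hf hg h) (key g f hg hf h.symm)

/-- An extreme point is not in the hull of the other generators, and a hyperplane separating it from
that hull exposes it. -/
theorem isFace_singleton {S : Finset V} {v : V}
    (hv : v ∈ (convexHull ℝ (S : Set V)).extremePoints ℝ) :
    IsFace (convexHull ℝ (S : Set V)) {v} := by
  classical
  have hconv := ((convex_convexHull ℝ (S : Set V)).mem_extremePoints_iff_convex_sdiff).1 hv
  have hsub : convexHull ℝ ((S.erase v : Finset V) : Set V) ⊆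
      convexHull ℝ (S : Set V) \ {v} := by
    refine convexHull_min (fun y hy => ?_) hconv.2
    rw [Finset.mem_coe, Finset.mem_erase] at hy
    exact ⟨subset_convexHull ℝ _ hy.2, hy.1⟩
  obtain ⟨l, c, hlv, hl⟩ := geometric_hahn_banach_point_closed (convex_convexHull ℝ _)
    (isCompact_convexHull_finset (S.erase v)).isClosed (fun h => (hsub h).2 rfl)
  set p := -(InnerProductSpace.toDual ℝ V).symm l with hp
  have hpl : ∀ x, ⟪p, x⟫ = -l x := fun x => by
    rw [hp, inner_neg_left, InnerProductSpace.toDual_symm_apply]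
  have hS : ∀ y ∈ S, y ≠ v → ⟪p, y - v⟫ < 0 := fun y hy hne => by
    have := hl y (subset_convexHull ℝ _ (Finset.mem_coe.2 (Finset.mem_erase.2 ⟨hne, hy⟩)))
    rw [hpl, map_sub]
    linarith
  have hface := isFace_argmax (p := p) hv.1 (inner_sub_nonpos_of_forall_finset fun y hy => by
    by_cases hne : y = v
    · simp [hne]
    · exact (hS y hy hne).le)
  have : {y | y ∈ convexHull ℝ (S : Set V) ∧ ⟪p, y - v⟫ = 0} = {v} := by
    refine Set.Subset.antisymm (hface.subset_of_finset isClosed_singleton (convex_singleton v)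
      fun s hs hsf => ?_) ?_
    · by_contra hne
      exact (hS s hs hne).ne hsf.2
    · rintro _ rfl
      exact ⟨hv.1, by simp⟩
  rwa [this] at hface

/-- Normal cones at vertices are full-dimensional. -/
theorem eq_zero_of_orth_normalCone {S : Finset V} {v x : V}
    (hv : v ∈ (convexHull ℝ (S : Set V)).extremePoints ℝ)
    (hx : ∀ n ∈ normalCone (convexHull ℝ (S : Set V)) {v}, ⟪x, n⟫ = 0) : x = 0 := by
  obtain ⟨p, hp, hpe⟩ := (isFace_singleton hv).exists_exposing
  obtain ⟨ε, hε, hmem⟩ := exists_add_smul_mem_normalCone (S := S) (v := v) (q := p) (x := x)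
    (fun y hy => by
      by_cases hyv : y = v
      · right
        simp [hyv]
      · left
        by_contra! hcon
        exact hyv (hpe v rfl y (subset_convexHull ℝ _ hy) hcon))
  have h1 := hx _ hmem
  rw [inner_add_right, hx p hp, zero_add, real_inner_smul_right] at h1
  exact inner_self_eq_zero.1 ((mul_eq_zero.1 h1).resolve_left hε.ne')

/-- Points near to the dilated tangent cones of `P` along a face `f` lie strictly inside the
dilated facets of `P` that do not meet `f`. -/
theorem eventually_inner_neg {S : Finset V} {f : Set V} {u m : V}
    (hf : IsFace (convexHull ℝ (S : Set V)) f)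
    (hm : m ∈ normalCone (convexHull ℝ (S : Set V)) {u})
    (hmf : ∀ v ∈ f.extremePoints ℝ, m ∉ normalCone (convexHull ℝ (S : Set V)) {v}) (κ ρ : ℝ) :
    ∀ᶠ t : ℕ in atTop, ∀ x z z' : V, ‖z' - z‖ ≤ κ → ‖z - x‖ ≤ ρ →
      (∀ v ∈ f.extremePoints ℝ, (∀ n ∈ normalCone (convexHull ℝ (S : Set V)) f,
        ⟪x - (t : ℝ) • v, n⟫ = 0) ∧
        ∃ q ∈ polar (normalCone (convexHull ℝ (S : Set V)) {v}), ‖z - (t : ℝ) • v - q‖ ≤ κ) →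
      ⟪z' - (t : ℝ) • u, m⟫ < 0 := by
  have hfc := hf.isCompact (isCompact_convexHull_finset S)
  -- With `v` maximizing `m` on `f` and `p` exposing `f`, the vector `p + ε • m` lies in `N_v`. It
  -- is bounded above at `z' - tv`, while `p` is bounded below there since `x - tv` is orthogonal to
  -- `N_f`. So `m` is bounded above at `z' - tv`, and passing from `v` to `u` adds a negative
  -- multiple of `t`.
  obtain ⟨v, hv, hmax⟩ := exists_extremePoint_max hfc hf.2 m
  have hvP := hf.subset hv.1
  have hneg : ⟪m, v - u⟫ < 0 :=
    lt_of_le_of_ne (mem_normalCone_singleton.1 hm v hvP)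
      fun h => hmf v hv (mem_normalCone_of_singleton hm h)
  obtain ⟨p, hp, hpe⟩ := hf.exists_exposing
  obtain ⟨ε, hε, hmem⟩ := exists_add_smul_mem_normalCone (S := S) (v := v) (q := p) (x := m)
    (fun y hy => by
      have hyP := subset_convexHull ℝ (S : Set V) hy
      by_cases hyf : y ∈ f
      · exact Or.inr ⟨hp v hv.1 y hyP, hmax y hyf⟩
      · left
        by_contra! hcon
        exact hyf (hpe v hv.1 y hyP hcon))
  set K := 2 * κ * ‖p + ε • m‖ + (κ + ρ) * ‖p‖ with hK
  have hlarge : ∀ᶠ t : ℕ in atTop, K / (ε * -⟪m, v - u⟫) < t :=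
    tendsto_natCast_atTop_atTop.eventually_gt_atTop _
  filter_upwards [hlarge] with t ht x z z' hzz' hzx hvx
  rw [div_lt_iff₀ (mul_pos hε (neg_pos.2 hneg))] at ht
  obtain ⟨hxv, q, hq, hzq⟩ := hvx v hv
  have h1 : ⟪z' - (t : ℝ) • v, p + ε • m⟫ ≤ 2 * κ * ‖p + ε • m‖ := by
    have h2 : z' - (t : ℝ) • v = ((z' - z) + (z - (t : ℝ) • v - q)) + q := by abel
    have h3 : ‖(z' - z) + (z - (t : ℝ) • v - q)‖ ≤ 2 * κ :=
      (norm_add_le _ _).trans (by linarith)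
    have h4 := (real_inner_le_norm ((z' - z) + (z - (t : ℝ) • v - q)) (p + ε • m)).trans
      (mul_le_mul_of_nonneg_right h3 (norm_nonneg _))
    rw [h2, inner_add_left]
    linarith [hq _ hmem]
  have h2 : -((κ + ρ) * ‖p‖) ≤ ⟪z' - (t : ℝ) • v, p⟫ := by
    have h2 : z' - (t : ℝ) • v = ((z' - z) + (z - x)) + (x - (t : ℝ) • v) := by abel
    have h3 : ‖(z' - z) + (z - x)‖ ≤ κ + ρ := (norm_add_le _ _).trans (add_le_add hzz' hzx)
    have h4 := (neg_le_abs _).trans ((abs_real_inner_le_norm ((z' - z) + (z - x)) p).trans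
      (mul_le_mul_of_nonneg_right h3 (norm_nonneg _)))
    rw [h2, inner_add_left, hxv p hp]
    linarith
  rw [inner_add_right, real_inner_smul_right] at h1
  have h3 : z' - (t : ℝ) • u = (z' - (t : ℝ) • v) + (t : ℝ) • (v - u) := by
    rw [smul_sub]; abel
  rw [h3, inner_add_left, real_inner_smul_left, real_inner_comm m (v - u)]
  have h4 : ε * (⟪z' - (t : ℝ) • v, m⟫ + t * ⟪m, v - u⟫) < 0 := by
    have : (t : ℝ) * (ε * -⟪m, v - u⟫) = -(ε * (t * ⟪m, v - u⟫)) := by ring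
    rw [mul_add]
    linarith
  by_contra! hcon
  exact absurd (mul_nonneg hε.le hcon) (not_le.2 h4)

/-- A polytope is the intersection of its tangent cones at the vertices: a separating functional
attains its maximum at a vertex `u` and so belongs to `N_u`. -/
theorem mem_smul_of_forall_polar {P : Set V} (hP : IsCompact P) (hPc : Convex ℝ P)
    (hne : P.Nonempty) {t : ℝ} (ht : 0 < t) {z : V}
    (h : ∀ u ∈ P.extremePoints ℝ, z - t • u ∈ polar (normalCone P {u})) : z ∈ t • P := by
  rw [Set.mem_smul_set_iff_inv_smul_mem₀ ht.ne']
  by_contra hz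
  obtain ⟨l, c, hl, hlz⟩ := geometric_hahn_banach_closed_point hPc hP.isClosed hz
  set n := (InnerProductSpace.toDual ℝ V).symm l
  have hn : ∀ x, ⟪n, x⟫ = l x := fun x => InnerProductSpace.toDual_symm_apply
  obtain ⟨u, hu, hmax⟩ := exists_extremePoint_max hP hne n
  have h1 := h u hu n (mem_normalCone_singleton.2 hmax)
  rw [real_inner_comm, hn, map_sub, map_smul, smul_eq_mul] at h1
  rw [map_smul, smul_eq_mul] at hlz
  have h2 := (hl u hu.1).trans hlz
  rw [lt_inv_mul_iff₀ ht] at h2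
  linarith

end Polytopes

/-! ### From vertex cones to the dilated polytope -/

section Gluing

variable {V : Type*} [NormedAddCommGroup V] [InnerProductSpace ℝ V] {Λ : Submodule ℤ V}
  {S : Finset V}

/-- A finite set of pairs consisting of a vertex and a unit generator of a ray of the normal cone
at that vertex, exhausting all such rays. -/
theorem exists_ray_generators (hS : (S : Set V) ⊆ Λ)
    (hdim : affineSpan ℝ (convexHull ℝ (S : Set V)) = ⊤)
    (hvert : ∀ u ∈ (convexHull ℝ (S : Set V)).extremePoints ℝ,
      IsFace (convexHull ℝ (S : Set V)) {u}) :
    ∃ F : Finset (V × V),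
      (∀ i ∈ F, i.1 ∈ (convexHull ℝ (S : Set V)).extremePoints ℝ ∧
        i.2 ∈ normalCone (convexHull ℝ (S : Set V)) {i.1}) ∧
      ∀ u ∈ (convexHull ℝ (S : Set V)).extremePoints ℝ, ∀ M,
        IsRay (normalCone (convexHull ℝ (S : Set V)) {u}) M →
        ∃ g, (u, g) ∈ F ∧ ‖g‖ = 1 ∧ M = {x | ∃ a : ℝ, 0 ≤ a ∧ x = a • g} := by
  classical
  set P := convexHull ℝ (S : Set V)
  have hgen : ∀ u : V, ∀ M, ∃ g : V, u ∈ P.extremePoints ℝ → IsRay (normalCone P {u}) M →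
      ‖g‖ = 1 ∧ M = {x | ∃ a : ℝ, 0 ≤ a ∧ x = a • g} := by
    intro u M
    by_cases h : u ∈ P.extremePoints ℝ ∧ IsRay (normalCone P {u}) M
    · obtain ⟨g, hg⟩ := (isPointedRationalCone_normalCone hS hdim
        (hvert u h.1)).exists_generator h.2
      exact ⟨g, fun _ _ => hg⟩
    · exact ⟨0, fun h1 h2 => absurd ⟨h1, h2⟩ h⟩
  choose g hg using hgen
  have hfin : (⋃ u ∈ P.extremePoints ℝ,
      (fun M => (u, g u M)) '' {M | IsRay (normalCone P {u}) M}).Finite := by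
    refine (S.finite_toSet.subset extremePoints_convexHull_subset).biUnion fun u hu => ?_
    exact ((isPointedRationalCone_normalCone hS hdim (hvert u hu)).finite_faces.subset
      fun M hM => hM.1).image _
  refine ⟨hfin.toFinset, fun i hi => ?_, fun u hu M hM => ⟨g u M, ?_, hg u M hu hM⟩⟩
  · rw [Set.Finite.mem_toFinset, Set.mem_iUnion₂] at hi
    obtain ⟨u, hu, M, hM, rfl⟩ := hi
    refine ⟨hu, hM.1.subset ?_⟩
    rw [(hg u M hu hM).2]
    exact ⟨1, zero_le_one, by rw [one_smul, ← (hg u M hu hM).2]⟩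
  · rw [Set.Finite.mem_toFinset, Set.mem_iUnion₂]
    exact ⟨u, hu, M, hM, rfl⟩

theorem natCast_smul_mem (hS : (S : Set V) ⊆ Λ) {v : V} (t : ℕ)
    (hv : v ∈ (convexHull ℝ (S : Set V)).extremePoints ℝ) : (t : ℝ) • v ∈ Λ := by
  rw [Nat.cast_smul_eq_nsmul]
  exact nsmul_mem (hS (extremePoints_convexHull_subset hv)) t

theorem smul_sub_mem_polar {P : Set V} {v p : V} (t : ℕ) (hp : p ∈ P) :
    (t : ℝ) • p - (t : ℝ) • v ∈ polar (normalCone P {v}) := by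
  intro n hn
  rw [← smul_sub, real_inner_smul_left, real_inner_comm]
  exact mul_nonpos_of_nonneg_of_nonpos (Nat.cast_nonneg t) (mem_normalCone_singleton.1 hn p hp)

theorem smul_sub_mem_inducedLattice (hS : (S : Set V) ⊆ Λ) {u v : V} {K : Set V} (t : ℕ)
    (hu : u ∈ (convexHull ℝ (S : Set V)).extremePoints ℝ)
    (hv : v ∈ (convexHull ℝ (S : Set V)).extremePoints ℝ)
    (hK : ∀ n ∈ K, ⟪n, v - u⟫ = 0) : (t : ℝ) • v - (t : ℝ) • u ∈ inducedLattice Λ K := by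
  refine mem_inducedLattice_iff.2
    ⟨sub_mem (natCast_smul_mem hS t hv) (natCast_smul_mem hS t hu), fun n hn => ?_⟩
  rw [← smul_sub, real_inner_smul_left, real_inner_comm, hK n hn, mul_zero]

variable [FiniteDimensional ℝ V] {T : Set V → Set V}

theorem isPointedRationalCone_normalCone_vertex (hS : (S : Set V) ⊆ Λ)
    (hdim : affineSpan ℝ (convexHull ℝ (S : Set V)) = ⊤) {u : V}
    (hu : u ∈ (convexHull ℝ (S : Set V)).extremePoints ℝ) :
    IsPointedRationalCone Λ (normalCone (convexHull ℝ (S : Set V)) {u}) :=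
  isPointedRationalCone_normalCone hS hdim (isFace_singleton hu)

theorem mem_feasiblePoints_iff {P f : Set V} {t : ℕ} {x : V} :
    x ∈ feasiblePoints Λ T P t f ↔ ∀ v ∈ f.extremePoints ℝ, x - (t : ℝ) • v ∈
      translationSet Λ (region Λ T) (normalCone P f) (normalCone P {v}) := by
  simp only [feasiblePoints, Set.mem_iInter, mem_vadd_iff]

variable [MeasurableSpace V] [BorelSpace V]

theorem exists_region_bound (hT : IsDomainChoice Λ T) (hS : (S : Set V) ⊆ Λ)
    (hdim : affineSpan ℝ (convexHull ℝ (S : Set V)) = ⊤) :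
    ∃ ρ : ℝ, ∀ f, IsFace (convexHull ℝ (S : Set V)) f →
      ∀ a ∈ region Λ T (normalCone (convexHull ℝ (S : Set V)) f), ‖a‖ ≤ ρ := by
  obtain ⟨ρ, hρ⟩ := ((Bornology.isBounded_biUnion (finite_faces_polytope S)).2 fun f hf =>
    isBounded_region hT (isPointedRationalCone_normalCone hS hdim hf)).exists_norm_le
  exact ⟨ρ, fun f hf a ha => hρ a (Set.mem_biUnion (x := f) hf ha)⟩

theorem exists_cell_bound (hT : IsDomainChoice Λ T) {C : Set V}
    (hC : IsPointedRationalCone Λ C) :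
    ∃ κ : ℝ, ∀ z y z' : V, z - y ∈ T {0} → z' - y ∈ T {0} → ‖z - z'‖ ≤ κ := by
  obtain ⟨δ, hδ⟩ := (hT _ (hC.face hC.isFace_zero)).bounded.exists_norm_le
  refine ⟨δ + δ, fun z y z' hz hz' => ?_⟩
  rw [← sub_sub_sub_cancel_right z z' y]
  exact (norm_sub_le _ _).trans (add_le_add (hδ _ hz) (hδ _ hz'))

/-- Translates of regions by feasible points are contained in the covering domain complex. -/
theorem eventually_translate_subset (hT : IsDomainChoice Λ T) (hS : (S : Set V) ⊆ Λ)
    (hdim : affineSpan ℝ (convexHull ℝ (S : Set V)) = ⊤) :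
    ∀ᶠ t : ℕ in atTop, ∀ f, IsFace (convexHull ℝ (S : Set V)) f →
      ∀ x ∈ feasiblePoints Λ T (convexHull ℝ (S : Set V)) t f, ∀ z : V,
      z - x ∈ region Λ T (normalCone (convexHull ℝ (S : Set V)) f) →
      z ∈ coveringComplex Λ (T {0}) ((t : ℝ) • convexHull ℝ (S : Set V)) := by
  classical
  obtain ⟨F, hF, hFgen⟩ := exists_ray_generators hS hdim fun u hu => isFace_singleton hu
  have hPc := isCompact_convexHull_finset S
  have hvr := fun {u : V} => isPointedRationalCone_normalCone_vertex (u := u) hS hdim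
  obtain ⟨ρ, hρ⟩ := exists_region_bound hT hS hdim
  set P := convexHull ℝ (S : Set V)
  by_cases hne : P.Nonempty
  swap
  · refine Filter.Eventually.of_forall fun t f hf => ?_
    exact absurd (hf.2.mono hf.subset) hne
  obtain ⟨v₀, hv₀⟩ := hPc.extremePoints_nonempty hne
  obtain ⟨κ, hκ⟩ := exists_cell_bound hT (hvr hv₀)
  have hlarge : ∀ᶠ t : ℕ in atTop, ∀ i ∈ F, ∀ f ∈ {f | IsFace P f},
      (∀ v ∈ f.extremePoints ℝ, i.2 ∉ normalCone P {v}) →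
      ∀ x z z' : V, ‖z' - z‖ ≤ κ → ‖z - x‖ ≤ ρ →
      (∀ v ∈ f.extremePoints ℝ, (∀ n ∈ normalCone P f, ⟪x - (t : ℝ) • v, n⟫ = 0) ∧
        ∃ q ∈ polar (normalCone P {v}), ‖z - (t : ℝ) • v - q‖ ≤ κ) →
      ⟪z' - (t : ℝ) • i.1, i.2⟫ < 0 := by
    rw [Filter.eventually_all_finset]
    intro i hi
    rw [Filter.eventually_all_finite (finite_faces_polytope S)]
    intro f hf
    by_cases h : ∀ v ∈ f.extremePoints ℝ, i.2 ∉ normalCone P {v}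
    · filter_upwards [eventually_inner_neg hf (hF i hi).2 h κ ρ] with t ht _
      exact ht
    · exact Filter.Eventually.of_forall fun t h' => absurd h' h
  filter_upwards [hlarge, eventually_gt_atTop 0] with t ht ht0 f hf x hx z hz
  rw [mem_feasiblePoints_iff] at hx
  have hfv : ∀ {v}, v ∈ f.extremePoints ℝ → v ∈ P.extremePoints ℝ :=
    fun hv => hf.extremePoints_subset hv
  have hfN : ∀ {v}, v ∈ f.extremePoints ℝ → IsFace (normalCone P {v}) (normalCone P f) :=
    fun hv => isFace_normalCone hf.subset hv.1 (hvr (hfv hv))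
  obtain ⟨v₁, hv₁⟩ := hf.extremePoints_nonempty hPc
  have hxL : ∀ v ∈ f.extremePoints ℝ, x - (t : ℝ) • v ∈ inducedLattice Λ (normalCone P f) :=
    fun v hv => translationSet_subset_inducedLattice (hx v hv)
  have hxorth : ∀ v ∈ f.extremePoints ℝ, ∀ n ∈ normalCone P f, ⟪x - (t : ℝ) • v, n⟫ = 0 :=
    fun v hv => (mem_inducedLattice_iff.1 (hxL v hv)).2
  have hxΛ : x ∈ Λ := by
    have := add_mem (mem_inducedLattice_iff.1 (hxL v₁ hv₁)).1 (natCast_smul_mem hS t (hfv hv₁))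
    rwa [sub_add_cancel] at this
  obtain ⟨y, hy, hzy, q, hq, hqy⟩ :=
    mem_coveringComplex_iff.1 (region_subset_coveringComplex hz)
  have hzy' : z - (x + y) ∈ T {0} := by rwa [← sub_sub]
  have hqy' : q + x - (x + y) ∈ T {0} := by rwa [add_comm q, add_sub_add_left_eq_sub]
  refine mem_coveringComplex_iff.2 ⟨x + y, add_mem hxΛ hy, hzy', q + x, ?_, hqy'⟩
  refine mem_smul_of_forall_polar hPc (convex_convexHull ℝ _) hne (Nat.cast_pos.2 ht0)
    fun u hu => (hvr hu).mem_polar_of_rays fun M hM m hm => ?_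
  obtain ⟨g, hgF, hg1, hMg⟩ := hFgen u hu M hM
  by_cases hm0 : m = 0
  · rw [hm0, inner_zero_right]
  have hmu : ∀ v ∈ P, ⟪m, v - u⟫ ≤ 0 := mem_normalCone_singleton.1 (hM.1.subset hm)
  -- As `m ∈ N_u`, the last term is nonpositive for `v ∈ P`, so the inequality at `u` may be checked
  -- at any vertex `v` of `f`. Three cases follow: `m` in `N_f`, `m` in `N_v` for some vertex `v` of
  -- `f`, or in none of these.
  have hsplit : ∀ v, ⟪q + x - (t : ℝ) • u, m⟫ =
      ⟪q + x - (t : ℝ) • v, m⟫ + t * ⟪m, v - u⟫ := by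
    intro v
    rw [real_inner_comm (v - u) m, ← real_inner_smul_left, ← inner_add_left, smul_sub]
    congr 1
    abel
  by_cases hmf : m ∈ normalCone P f
  · rw [hsplit v₁, add_sub_assoc, inner_add_left, hxorth v₁ hv₁ m hmf, add_zero]
    exact add_nonpos (hq m hmf)
      (mul_nonpos_of_nonneg_of_nonpos (Nat.cast_nonneg t) (hmu v₁ (hfv hv₁).1))
  obtain ⟨a, ha, hag⟩ : ∃ a : ℝ, 0 < a ∧ m = a • g := by
    rw [hMg] at hm
    obtain ⟨a, ha, rfl⟩ := hm
    exact ⟨a, lt_of_le_of_ne ha (by rintro rfl; simp at hm0), rfl⟩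
  by_cases hex : ∃ v ∈ f.extremePoints ℝ, g ∈ normalCone P {v}
  · obtain ⟨v, hv, hgv⟩ := hex
    have hr := hvr (hfv hv)
    have hMv : M ⊆ normalCone P {v} := by
      rw [hMg]
      rintro _ ⟨b, hb, rfl⟩
      exact hr.refl.smul_mem g hgv b hb
    have hMray : IsRay (normalCone P {v}) M := by
      have h1 := isFace_inter_normalCone (hfv hv).1 hu.1 hr
      have h2 := isFace_inter_normalCone hu.1 (hfv hv).1 (hvr hu)
      rw [Set.inter_comm] at h2
      exact (hM.face_mono (hvr hu) h2 (Set.subset_inter hMv hM.1.subset)).face_trans hr h1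
    have hKC : normalCone P f ≠ normalCone P {v} := fun h => hmf (h ▸ hMv hm)
    have hneg := cell_inner_neg hT hr ⟨hfN hv, hKC⟩ (hx v hv) (z := z - (t : ℝ) • v)
      (z' := q + x - (t : ℝ) • v) (y := x + y - (t : ℝ) • v) (m := m) (M := M)
      (by rwa [sub_sub_sub_cancel_right])
      (sub_mem (add_mem hxΛ hy) (natCast_smul_mem hS t (hfv hv)))
      (by rwa [sub_sub_sub_cancel_right]) hMray (fun h => hmf (h hm)) hm hm0
      (by rwa [sub_sub_sub_cancel_right])
    rw [hsplit v]
    exact add_nonpos hneg.le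
      (mul_nonpos_of_nonneg_of_nonpos (Nat.cast_nonneg t) (hmu v (hfv hv).1))
  · push Not at hex
    have := ht (u, g) hgF f hf hex x z (q + x) (hκ _ _ _ hqy' hzy') (hρ f hf _ hz)
      fun v hv => ⟨hxorth v hv, ?_⟩
    · rw [hag, real_inner_smul_right]
      exact mul_nonpos_of_nonneg_of_nonpos ha.le this.le
    · have hcc := translate_region_subset hT (hvr (hfv hv)) (hfN hv) (hx v hv)
        (z := z - (t : ℝ) • v) (by rwa [sub_sub_sub_cancel_right])
      obtain ⟨y', -, h1, q', hq', h2⟩ := mem_coveringComplex_iff.1 hcc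
      exact ⟨q', hq', hκ _ _ _ h1 h2⟩

/-- Every point of the covering domain complex is covered by a translate of a region. -/
theorem eventually_exists_mem_translate (hT : IsDomainChoice Λ T) (hS : (S : Set V) ⊆ Λ)
    (hdim : affineSpan ℝ (convexHull ℝ (S : Set V)) = ⊤) :
    ∀ᶠ t : ℕ in atTop, ∀ z ∈ coveringComplex Λ (T {0}) ((t : ℝ) • convexHull ℝ (S : Set V)),
      ∃ f, IsFace (convexHull ℝ (S : Set V)) f ∧
        ∃ x ∈ feasiblePoints Λ T (convexHull ℝ (S : Set V)) t f,
          z - x ∈ region Λ T (normalCone (convexHull ℝ (S : Set V)) f) := by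
  classical
  obtain ⟨F, hF, hFgen⟩ := exists_ray_generators hS hdim fun u hu => isFace_singleton hu
  have hPc := isCompact_convexHull_finset S
  have hvr := fun {u : V} => isPointedRationalCone_normalCone_vertex (u := u) hS hdim
  obtain ⟨ρ, hρ⟩ := exists_region_bound hT hS hdim
  set P := convexHull ℝ (S : Set V)
  by_cases hne : P.Nonempty
  swap
  · refine Filter.Eventually.of_forall fun t z hz => ?_
    obtain ⟨-, -, -, _, ⟨p, hp, -⟩, -⟩ := mem_coveringComplex_iff.1 hz
    exact absurd ⟨p, hp⟩ hne
  obtain ⟨v₀, hv₀⟩ := hPc.extremePoints_nonempty hne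
  obtain ⟨κ, hκ⟩ := exists_cell_bound hT (hvr hv₀)
  have hlarge : ∀ᶠ t : ℕ in atTop, ∀ A ∈ F.powerset, ∀ z : V,
      (∃ p ∈ P, ‖z - (t : ℝ) • p‖ ≤ κ) →
      (∀ i ∈ A, -(3 * ρ) ≤ ⟪i.2, z - (t : ℝ) • i.1⟫) →
      ∃ v ∈ P.extremePoints ℝ, ∀ i ∈ A, ⟪i.2, v - i.1⟫ = 0 := by
    rw [Filter.eventually_all_finset]
    intro A hA
    exact eventually_exists_common_vertex hPc hne A
      (fun i hi => mem_normalCone_singleton.1 (hF i (Finset.mem_powerset.1 hA hi)).2) κ (3 * ρ)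
  filter_upwards [hlarge] with t ht z hz
  obtain ⟨y, hy, hzy, _, ⟨p, hp, rfl⟩, hpy⟩ := mem_coveringComplex_iff.1 hz
  change (t : ℝ) • p - y ∈ T {0} at hpy
  -- All walls within the margin `3ρ` of `z` pass through a common vertex `v`. The tiling at `v`
  -- supplies the tile; all walls not containing `v` are far from `z`.
  obtain ⟨v, hv, hvA⟩ := ht (F.filter fun i => -(3 * ρ) ≤ ⟪i.2, z - (t : ℝ) • i.1⟫)
    (Finset.mem_powerset.2 (Finset.filter_subset _ _)) z ⟨p, hp, hκ _ _ _ hzy hpy⟩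
    fun i hi => (Finset.mem_filter.1 hi).2
  have hr := hvr hv
  have hcc : z - (t : ℝ) • v ∈ coveringComplex Λ (T {0}) (polar (normalCone P {v})) :=
    mem_coveringComplex_iff.2 ⟨y - (t : ℝ) • v, sub_mem hy (natCast_smul_mem hS t hv),
      by rwa [sub_sub_sub_cancel_right], (t : ℝ) • p - (t : ℝ) • v, smul_sub_mem_polar t hp,
      by rwa [sub_sub_sub_cancel_right]⟩
  obtain ⟨G, hG, x', hx', hzx'⟩ := exists_mem_region hT hr hcc
  obtain ⟨f, hf, hvf, rfl⟩ := exists_face_normalCone_eq hv.1 hG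
  have hx'X : x' ∈ translationSet Λ (region Λ T) (normalCone P f) (normalCone P {v}) := by
    by_cases heq : normalCone P f = normalCone P {v}
    · rw [heq, latticeTranslationSet_self] at hx'
      rw [heq, translationSet_self, Set.mem_singleton_iff]
      exact eq_zero_of_orth_normalCone hv (mem_inducedLattice_iff.1 hx').2
    · rwa [latticeTranslationSet_of_ne heq] at hx'
  refine ⟨f, hf, x' + (t : ℝ) • v, mem_feasiblePoints_iff.2 fun u hu => ?_, ?_⟩
  swap
  · rwa [add_comm, ← sub_sub]
  have huP := hf.extremePoints_subset hu
  have hru := hvr huP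
  have hfu : IsFace (normalCone P {u}) (normalCone P f) := isFace_normalCone hf.subset hu.1 hru
  by_cases heq : normalCone P f = normalCone P {u}
  · have hfu' := hf.eq_of_normalCone_eq (isFace_singleton huP) heq
    have hvu : v = u := by
      rw [hfu'] at hvf
      exact hvf
    rw [← hvu, add_sub_cancel_right]
    exact hx'X
  have hKu : IsFace (normalCone P {u}) (normalCone P {u} ∩ normalCone P {v}) :=
    isFace_inter_normalCone huP.1 hv.1 hru
  have hKv : IsFace (normalCone P {v}) (normalCone P {u} ∩ normalCone P {v}) := by
    rw [Set.inter_comm]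
    exact isFace_inter_normalCone hv.1 huP.1 hr
  have hfK : IsFace (normalCone P {u} ∩ normalCone P {v}) (normalCone P f) :=
    hru.face_mono hKu hfu (Set.subset_inter hfu.subset hG.subset)
  -- Feasibility moves from `v` to `u` through the common face `N_u ∩ N_v`: restrict to it, shift by
  -- this lattice vector orthogonal to it, then extend to `N_u`, whose rays outside `N_v` have walls
  -- far from `z`.
  have hshift : (t : ℝ) • v - (t : ℝ) • u ∈
      inducedLattice Λ (normalCone P {u} ∩ normalCone P {v}) := by
    refine smul_sub_mem_inducedLattice hS t huP hv fun n hn => ?_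
    have h1 := mem_normalCone_singleton.1 hn.1 v hv.1
    have h2 := mem_normalCone_singleton.1 hn.2 u huP.1
    rw [inner_sub_right] at *
    linarith
  have hxK := add_mem_latticeTranslationSet (hru.face hKu) hfK
    (translationSet_subset_face hr hKv hfK hx'X) hshift
  rw [← add_sub_assoc] at hxK
  refine mem_translationSet_of_far hru hKu hfK heq (ρ := ρ) (fun K hK a ha => ?_) hxK
    (z := z - (t : ℝ) • u) ?_ fun M hM hMK m hm hm0 => ?_
  · obtain ⟨f', hf', -, rfl⟩ := exists_face_normalCone_eq huP.1 hK.1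
    exact hρ f' hf' a ha
  · rw [sub_sub_sub_cancel_right, add_comm, ← sub_sub]
    exact hzx'
  · obtain ⟨g, hgF, hg1, hMg⟩ := hFgen u huP M hM
    have hfar : ⟪g, z - (t : ℝ) • u⟫ < -(3 * ρ) := by
      by_contra! hcon
      have h0 := hvA (u, g) (Finset.mem_filter.2 ⟨hgF, hcon⟩)
      refine hMK (Set.subset_inter hM.1.subset ?_)
      rw [hMg]
      rintro _ ⟨b, hb, rfl⟩
      exact hr.refl.smul_mem g (mem_normalCone_of_singleton (hF _ hgF).2 h0) b hb
    rw [hMg] at hm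
    obtain ⟨a, ha, rfl⟩ := hm
    have ha' : 0 < a := lt_of_le_of_ne ha (by rintro rfl; simp at hm0)
    rw [real_inner_smul_right, norm_smul, hg1, Real.norm_of_nonneg ha, real_inner_comm]
    have := mul_lt_mul_of_pos_left hfar ha'
    linarith

/-- Translates of regions by feasible points are pairwise disjoint. -/
theorem eventually_translate_unique (hT : IsDomainChoice Λ T) (hS : (S : Set V) ⊆ Λ)
    (hdim : affineSpan ℝ (convexHull ℝ (S : Set V)) = ⊤) :
    ∀ᶠ t : ℕ in atTop, ∀ f, IsFace (convexHull ℝ (S : Set V)) f →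
      ∀ f', IsFace (convexHull ℝ (S : Set V)) f' →
      ∀ x ∈ feasiblePoints Λ T (convexHull ℝ (S : Set V)) t f,
      ∀ x' ∈ feasiblePoints Λ T (convexHull ℝ (S : Set V)) t f', ∀ z : V,
      z - x ∈ region Λ T (normalCone (convexHull ℝ (S : Set V)) f) →
      z - x' ∈ region Λ T (normalCone (convexHull ℝ (S : Set V)) f') → f = f' ∧ x = x' := by
  classical
  have hPc := isCompact_convexHull_finset S
  have hvr := fun {u : V} => isPointedRationalCone_normalCone_vertex (u := u) hS hdim
  obtain ⟨ρ, hρ⟩ := exists_region_bound hT hS hdim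
  have hsub := eventually_translate_subset hT hS hdim
  set P := convexHull ℝ (S : Set V)
  by_cases hne : P.Nonempty
  swap
  · refine Filter.Eventually.of_forall fun t f hf => ?_
    exact absurd (hf.2.mono hf.subset) hne
  obtain ⟨v₀, hv₀⟩ := hPc.extremePoints_nonempty hne
  obtain ⟨κ, hκ⟩ := exists_cell_bound hT (hvr hv₀)
  have hdata : ∀ f, ∃ i : V × V, IsFace P f → i.1 ∈ f.extremePoints ℝ ∧ i.2 ∈ normalCone P f ∧
      ∀ y ∈ P, 0 ≤ ⟪i.2, y - i.1⟫ → y ∈ f := by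
    intro f
    by_cases hf : IsFace P f
    · obtain ⟨p, hp, hpe⟩ := hf.exists_exposing
      obtain ⟨v, hv⟩ := hf.extremePoints_nonempty hPc
      exact ⟨(v, p), fun _ => ⟨hv, hp, hpe v hv.1⟩⟩
    · exact ⟨0, fun h => absurd h hf⟩
  choose i hi using hdata
  have hlarge : ∀ᶠ t : ℕ in atTop, ∀ f ∈ {f | IsFace P f}, ∀ f' ∈ {f | IsFace P f}, ∀ z : V,
      (∃ p ∈ P, ‖z - (t : ℝ) • p‖ ≤ κ) →
      (∀ j ∈ ({i f, i f'} : Finset (V × V)),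
        -(‖(i f).2‖ * ρ + ‖(i f').2‖ * ρ) ≤ ⟪j.2, z - (t : ℝ) • j.1⟫) →
      ∃ v ∈ P.extremePoints ℝ, ∀ j ∈ ({i f, i f'} : Finset (V × V)), ⟪j.2, v - j.1⟫ = 0 := by
    rw [Filter.eventually_all_finite (finite_faces_polytope S)]
    intro f hf
    rw [Filter.eventually_all_finite (finite_faces_polytope S)]
    intro f' hf'
    refine eventually_exists_common_vertex hPc hne _ (fun j hj => ?_) κ _
    rw [Finset.mem_insert, Finset.mem_singleton] at hj
    rcases hj with rfl | rfl
    · exact (hi f hf).2.1 _ (hi f hf).1.1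
    · exact (hi f' hf').2.1 _ (hi f' hf').1.1
  filter_upwards [hlarge, hsub] with t ht htsub f hf f' hf' x hx x' hx' z hz hz'
  -- A feasible point lies on the dilated hyperplane exposing its face, so `z` is within a bounded
  -- distance of it. Being near two such hyperplanes forces a vertex common to `f` and `f'`, where
  -- uniqueness for cones applies.
  have hnear : ∀ g, IsFace P g → ∀ y ∈ feasiblePoints Λ T P t g,
      z - y ∈ region Λ T (normalCone P g) →
      -(‖(i g).2‖ * ρ) ≤ ⟪(i g).2, z - (t : ℝ) • (i g).1⟫ := by
    intro g hg y hy hzy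
    have h1 := (mem_inducedLattice_iff.1 (translationSet_subset_inducedLattice
      (mem_feasiblePoints_iff.1 hy _ (hi g hg).1))).2 _ (hi g hg).2.1
    have h2 := (neg_le_abs _).trans ((abs_real_inner_le_norm (i g).2 (z - y)).trans
      (mul_le_mul_of_nonneg_left (hρ g hg _ hzy) (norm_nonneg _)))
    rw [← sub_add_sub_cancel z y, inner_add_right, real_inner_comm (y - (t : ℝ) • (i g).1),
      h1]
    linarith
  have hρ0 : 0 ≤ ρ := (norm_nonneg _).trans (hρ f hf _ hz)
  obtain ⟨y, hy, hzy, _, ⟨p, hp, rfl⟩, hpy⟩ :=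
    mem_coveringComplex_iff.1 (htsub f hf x hx z hz)
  obtain ⟨v, hv, hvA⟩ := ht f hf f' hf' z ⟨p, hp, hκ _ _ _ hzy hpy⟩ (fun j hj => by
    have h1 := mul_nonneg (norm_nonneg (i f).2) hρ0
    have h2 := mul_nonneg (norm_nonneg (i f').2) hρ0
    rw [Finset.mem_insert, Finset.mem_singleton] at hj
    rcases hj with rfl | rfl
    · linarith [hnear f hf x hx hz]
    · linarith [hnear f' hf' x' hx' hz'])
  have hvf := (hi f hf).2.2 v hv.1 (hvA (i f) (by simp)).ge
  have hvf' := (hi f' hf').2.2 v hv.1 (hvA (i f') (by simp)).ge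
  have hr := hvr hv
  obtain ⟨h1, h2⟩ := cone_tiling_unique hT hr (isFace_normalCone hf.subset hvf hr)
    (isFace_normalCone hf'.subset hvf' hr)
    (mem_feasiblePoints_iff.1 hx v (hf.mem_extremePoints hv hvf))
    (mem_feasiblePoints_iff.1 hx' v (hf'.mem_extremePoints hv hvf')) (z := z - (t : ℝ) • v)
    (by rwa [sub_sub_sub_cancel_right]) (by rwa [sub_sub_sub_cancel_right])
  exact ⟨hf.eq_of_normalCone_eq hf' h1, sub_left_injective h2⟩

end Gluing

end LatticeTiling

theorem theorem1 {V : Type*} [NormedAddCommGroup V] [InnerProductSpace ℝ V]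
    [FiniteDimensional ℝ V] [MeasurableSpace V] [BorelSpace V]
    (Λ : Submodule ℤ V) [DiscreteTopology Λ] [IsZLattice ℝ Λ]
    (T : Set V → Set V)
    (hT : ∀ C : Set V, LatticeTiling.IsPointedRationalCone Λ C →
      LatticeTiling.IsFundamentalDomain (LatticeTiling.inducedLattice Λ C) (T C))
    (P : Set V) (hP : LatticeTiling.IsLatticePolytope Λ P) (hdim : affineSpan ℝ P = ⊤) :
    ∃ t₀ : ℕ, 0 < t₀ ∧ ∀ t : ℕ, t₀ ≤ t →
      LatticeTiling.IsTiling
        (LatticeTiling.coveringComplex Λ (T {0}) ((t : ℝ) • P))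
        (fun i : {p : Set V × V //
            LatticeTiling.IsFace P p.1 ∧ p.2 ∈ LatticeTiling.feasiblePoints Λ T P t p.1} =>
          i.1.2 +ᵥ LatticeTiling.region Λ T (LatticeTiling.normalCone P i.1.1)) := by
  obtain ⟨S, hS, rfl⟩ := hP
  obtain ⟨t₁, ht₁⟩ := Filter.eventually_atTop.1
    ((LatticeTiling.eventually_translate_subset hT hS hdim).and
      ((LatticeTiling.eventually_exists_mem_translate hT hS hdim).and
        (LatticeTiling.eventually_translate_unique hT hS hdim)))
  refine ⟨max t₁ 1, by simp, fun t ht => ?_⟩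
  obtain ⟨hsub, hcov, huniq⟩ := ht₁ t ((le_max_left _ _).trans ht)
  refine ⟨?_, fun z hz => ?_, ?_⟩
  · rintro ⟨⟨f, x⟩, hf, hx⟩ z hz
    exact hsub f hf x hx z (LatticeTiling.mem_vadd_iff.1 hz)
  · obtain ⟨f, hf, x, hx, hzx⟩ := hcov z hz
    exact Set.mem_iUnion.2 ⟨⟨(f, x), hf, hx⟩, LatticeTiling.mem_vadd_iff.2 hzx⟩
  · rintro ⟨⟨f, x⟩, hf, hx⟩ ⟨⟨f', x'⟩, hf', hx'⟩ hne
    refine Set.disjoint_left.2 fun z hz hz' => hne ?_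
    obtain ⟨rfl, rfl⟩ := huniq f hf f' hf' x hx x' hx' z (LatticeTiling.mem_vadd_iff.1 hz)
      (LatticeTiling.mem_vadd_iff.1 hz')
    rfl
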